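/- Let $\mathcal{E}$ be an essentially small exact category in the sense of Quillen, i.e. an additive category with a class of kernel-cokernel pairs $A \rightarrowtail B \twoheadrightarrow C$ (the short exact sequences), closed under isomorphisms and satisfying Quillen's axioms. Assume that $\mathcal{E}$ is weakly idempotent complete: whenever $p : X \to Y$ and $i : Y \to X$ satisfy $p i = \mathrm{id}_Y$, the morphism $p$ has a kernel and $i$ has a cokernel. A complex $N$ over $\mathcal{E}$ is called acyclic if there are short exact sequences $Z^n \overset{i^{n}}{\rightarrowtail} N^n \overset{p^n}{\twoheadrightarrow} Z^{n+1}$ $(n \in \mathbb{Z})$ with $d_N^n = i^{n+1} p^n$ for all $n$. Let $\mathsf{D}^b(\mathcal{E})$ be the bounded derived category of $\mathcal{E}$, i.e. the Verdier quotient of the homotopy category $\mathsf{K}^b(\mathcal{E})$ of bounded complexes over $\mathcal{E}$ by the full triangulated subcategory of the objects isomorphic in $\mathsf{K}^b(\mathcal{E})$ to an acyclic complex. Let $\mathsf{K}_0(\mathcal{E})$ be the free abelian group on the isomorphism classes of objects of $\mathcal{E}$ modulo the subgroup generated by the elements $[A]-[B]+[C]$ for all short exact sequences $A \rightarrowtail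 B \twoheadrightarrow C$, and, for a triangulated category $\mathcal{T}$, let $\mathsf{K}_0(\mathcal{T})$ be the free abelian group on the isomorphism classes of objects of $\mathcal{T}$ modulo the subgroup generated by the elements $[A]-[B]+[C]$ for all exact triangles $A \to B \to C \to A[1]$. Then the canonical functor $\iota : \mathcal{E} \to \mathsf{D}^b(\mathcal{E})$, which sends an object to the complex concentrated in degree $0$, induces an isomorphism of abelian groups $$\varphi : \mathsf{K}_0(\mathcal{E}) \xrightarrow{\ \cong\ } \mathsf{K}_0(\mathsf{D}^b(\mathcal{E})), \qquad [X] \mapsto [\iota X].$$ -/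

import Mathlib

open CategoryTheory CategoryTheory.Limits CategoryTheory.Pretriangulated
open scoped ZeroObject

universe w v u

namespace ExactCat

section ExactCategories

variable {E : Type u} [Category.{v} E] [Preadditive E]

/-- With respect to a class `C` of short complexes, an admissible monomorphism is a morphism that
occurs as the first morphism of a member of `C`. -/
def IsAdmissibleMono (C : ObjectProperty (ShortComplex E)) {X Y : E} (f : X ⟶ Y) : Prop :=
  ∃ (Z : E) (g : Y ⟶ Z) (w : f ≫ g = 0), C (ShortComplex.mk f g w)

/-- With respect to a class `C` of short complexes, an admissible epimorphism is a morphism that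
occurs as the second morphism of a member of `C`. -/
def IsAdmissibleEpi (C : ObjectProperty (ShortComplex E)) {Y Z : E} (g : Y ⟶ Z) : Prop :=
  ∃ (X : E) (f : X ⟶ Y) (w : f ≫ g = 0), C (ShortComplex.mk f g w)


end ExactCategories

/-- An exact category in the sense of Quillen: an additive category `E` with a class of
kernel-cokernel pairs, the *short exact sequences* (or conflations) `A ↣ B ↠ C`, which is closed
under isomorphisms and satisfies Quillen's axioms. -/
class ExactCategory (E : Type u) [Category.{v} E] [Preadditive E] [HasZeroObject E]
    [HasBinaryBiproducts E] where
  /-- The class of short exact sequences of the exact structure. -/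
  conflation : ObjectProperty (ShortComplex E)
  /-- The class of short exact sequences is closed under isomorphisms. -/
  of_iso {S T : ShortComplex E} (e : S ≅ T) (hS : conflation S) : conflation T
  /-- In a short exact sequence, the first morphism is a kernel of the second. -/
  isKernel {S : ShortComplex E} (hS : conflation S) :
    Nonempty (IsLimit (KernelFork.ofι S.f S.zero))
  /-- In a short exact sequence, the second morphism is a cokernel of the first. -/
  isCokernel {S : ShortComplex E} (hS : conflation S) :
    Nonempty (IsColimit (CokernelCofork.ofπ S.g S.zero))
  /-- Identities are admissible monomorphisms. -/
  id_mono (X : E) : IsAdmissibleMono conflation (𝟙 X)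
  /-- Identities are admissible epimorphisms. -/
  id_epi (X : E) : IsAdmissibleEpi conflation (𝟙 X)
  /-- Admissible monomorphisms are closed under composition. -/
  comp_mono {X Y Z : E} (f : X ⟶ Y) (g : Y ⟶ Z) (hf : IsAdmissibleMono conflation f)
    (hg : IsAdmissibleMono conflation g) : IsAdmissibleMono conflation (f ≫ g)
  /-- Admissible epimorphisms are closed under composition. -/
  comp_epi {X Y Z : E} (f : X ⟶ Y) (g : Y ⟶ Z) (hf : IsAdmissibleEpi conflation f)
    (hg : IsAdmissibleEpi conflation g) : IsAdmissibleEpi conflation (f ≫ g)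
  /-- Pushouts of admissible monomorphisms along arbitrary morphisms exist and are admissible
  monomorphisms. -/
  pushout {X Y X' : E} (f : X ⟶ Y) (g : X ⟶ X') (hf : IsAdmissibleMono conflation f) :
    ∃ (Y' : E) (g' : Y ⟶ Y') (f' : X' ⟶ Y'),
      IsPushout f g g' f' ∧ IsAdmissibleMono conflation f'
  /-- Pullbacks of admissible epimorphisms along arbitrary morphisms exist and are admissible
  epimorphisms. -/
  pullback {Y Z Z' : E} (f : Y ⟶ Z) (g : Z' ⟶ Z) (hf : IsAdmissibleEpi conflation f) :
    ∃ (Y' : E) (g' : Y' ⟶ Y) (f' : Y' ⟶ Z'),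
      IsPullback g' f' f g ∧ IsAdmissibleEpi conflation f'

/-- A category is weakly idempotent complete if every retraction has a kernel and every section
has a cokernel. -/
def IsWeaklyIdempotentComplete (E : Type u) [Category.{v} E] [Preadditive E] : Prop :=
  ∀ ⦃X Y : E⦄ (p : X ⟶ Y) (i : Y ⟶ X), i ≫ p = 𝟙 Y → HasKernel p ∧ HasCokernel i

section ExactCategories

variable {E : Type u} [Category.{v} E] [Preadditive E] [HasZeroObject E]
  [HasBinaryBiproducts E] [ExactCategory E]

/-- `X --f--> Y --g--> Z` is a short exact sequence of the exact category `E`. -/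
def IsShortExact {X Y Z : E} (f : X ⟶ Y) (g : Y ⟶ Z) : Prop :=
  ∃ w : f ≫ g = 0, ExactCategory.conflation (ShortComplex.mk f g w)

namespace IsShortExact

variable {X Y Z : E} {f : X ⟶ Y} {g : Y ⟶ Z}

lemma admMono (h : IsShortExact f g) : IsAdmissibleMono ExactCategory.conflation f :=
  ⟨_, g, h.1, h.2⟩

lemma admEpi (h : IsShortExact f g) : IsAdmissibleEpi ExactCategory.conflation g :=
  ⟨_, f, h.1, h.2⟩

lemma mono (h : IsShortExact f g) : Mono f := by
  obtain ⟨w, h⟩ := h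
  obtain ⟨hl⟩ := ExactCategory.isKernel h
  exact mono_of_isLimit_fork hl

lemma epi (h : IsShortExact f g) : Epi g := by
  obtain ⟨w, h⟩ := h
  obtain ⟨hl⟩ := ExactCategory.isCokernel h
  exact epi_of_isColimit_cofork hl

lemma lift (h : IsShortExact f g) {T : E} (t : T ⟶ Y) (ht : t ≫ g = 0) :
    ∃ l : T ⟶ X, l ≫ f = t := by
  obtain ⟨w, h⟩ := h
  obtain ⟨hl⟩ := ExactCategory.isKernel h
  obtain ⟨l, hl⟩ := KernelFork.IsLimit.lift' hl t ht
  exact ⟨l, hl⟩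

lemma desc (h : IsShortExact f g) {T : E} (t : Y ⟶ T) (ht : f ≫ t = 0) :
    ∃ l : Z ⟶ T, g ≫ l = t := by
  obtain ⟨w, h⟩ := h
  obtain ⟨hl⟩ := ExactCategory.isCokernel h
  obtain ⟨l, hl⟩ := CokernelCofork.IsColimit.desc' hl t ht
  exact ⟨l, hl⟩

lemma of_iso (h : IsShortExact f g) {X' Y' Z' : E} {f' : X' ⟶ Y'} {g' : Y' ⟶ Z'}
    (a : X ≅ X') (b : Y ≅ Y') (c : Z ≅ Z') (hf : f ≫ b.hom = a.hom ≫ f')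
    (hg : g ≫ c.hom = b.hom ≫ g') : IsShortExact f' g' := by
  obtain ⟨w, h⟩ := h
  have w' : f' ≫ g' = 0 := by
    rw [← cancel_epi a.hom, ← reassoc_of% hf, ← hg, reassoc_of% w]
    simp
  exact ⟨w', ExactCategory.of_iso
    (ShortComplex.isoMk (S₁ := ShortComplex.mk f g w) (S₂ := ShortComplex.mk f' g' w')
      a b c hf.symm hg.symm) h⟩

lemma of_admMono (hf : IsAdmissibleMono ExactCategory.conflation f) (w : f ≫ g = 0) [Epi g]
    (hg : ∀ {T : E} (t : Y ⟶ T), f ≫ t = 0 → ∃ l : Z ⟶ T, g ≫ l = t) : IsShortExact f g := by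
  obtain ⟨C, q, wq, hq⟩ := hf
  have h : IsShortExact f q := ⟨wq, hq⟩
  have := h.epi
  obtain ⟨l, hl⟩ := hg q wq
  obtain ⟨m, hm⟩ := h.desc g w
  refine h.of_iso (Iso.refl X) (Iso.refl Y) ⟨m, l, ?_, ?_⟩ (by simp) (by simpa using hm)
  · rw [← cancel_epi q, reassoc_of% hm, hl]; simp
  · rw [← cancel_epi g, reassoc_of% hl, hm]; simp

lemma of_admEpi (hg : IsAdmissibleEpi ExactCategory.conflation g) (w : f ≫ g = 0) [Mono f]
    (hf : ∀ {T : E} (t : T ⟶ Y), t ≫ g = 0 → ∃ l : T ⟶ X, l ≫ f = t) : IsShortExact f g := by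
  obtain ⟨C, q, wq, hq⟩ := hg
  have h : IsShortExact q g := ⟨wq, hq⟩
  have := h.mono
  obtain ⟨l, hl⟩ := hf q wq
  obtain ⟨m, hm⟩ := h.lift f w
  refine h.of_iso ⟨l, m, ?_, ?_⟩ (Iso.refl Y) (Iso.refl Z) (by simpa using hl.symm) (by simp)
  · rw [← cancel_mono q, Category.assoc, hm, hl]; simp
  · rw [← cancel_mono f, Category.assoc, hl, hm]; simp

lemma _root_.ExactCat.admMono_of_isPushout {X Y X' Y' : E} {f : X ⟶ Y} {g : X ⟶ X'}
    {g' : Y ⟶ Y'} {f' : X' ⟶ Y'} (hf : IsAdmissibleMono ExactCategory.conflation f)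
    (h : IsPushout f g g' f') : IsAdmissibleMono ExactCategory.conflation f' := by
  obtain ⟨P, a, b, hP, C, q, w, hq⟩ := ExactCategory.pushout f g hf
  let e := hP.isoIsPushout _ _ h
  have h' : IsShortExact b q := ⟨w, hq⟩
  exact (h'.of_iso (f' := f') (g' := e.inv ≫ q) (Iso.refl _) e (Iso.refl _)
    (by simp [e]) (by simp)).admMono

lemma _root_.ExactCat.admEpi_of_isPullback {Y Z Y' Z' : E} {f : Y ⟶ Z} {g : Z' ⟶ Z}
    {g' : Y' ⟶ Y} {f' : Y' ⟶ Z'} (hf : IsAdmissibleEpi ExactCategory.conflation f)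
    (h : IsPullback g' f' f g) : IsAdmissibleEpi ExactCategory.conflation f' := by
  obtain ⟨P, a, b, hP, C, q, w, hq⟩ := ExactCategory.pullback f g hf
  let e := hP.isoIsPullback _ _ h
  have h' : IsShortExact q b := ⟨w, hq⟩
  exact (h'.of_iso (f' := q ≫ e.hom) (g' := f') (Iso.refl _) e (Iso.refl _)
    (by simp) (by simp [e])).admEpi

lemma zero (X : E) {O : E} (hO : IsZero O) : IsShortExact (𝟙 X) (0 : X ⟶ O) := by
  have : Epi (0 : X ⟶ O) := ⟨fun a b _ => hO.eq_of_src a b⟩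
  exact of_admMono (ExactCategory.id_mono X) (by simp)
    (fun t ht => ⟨0, by simpa using ht.symm⟩)

end IsShortExact



lemma admMono_map (B : E) {X Y : E} {i : X ⟶ Y}
    (hi : IsAdmissibleMono ExactCategory.conflation i) :
    IsAdmissibleMono ExactCategory.conflation (biprod.map (𝟙 B) i) := by
  refine admMono_of_isPushout (g := biprod.inr) (g' := biprod.inr) hi
    ⟨⟨by simp⟩, ⟨PushoutCocone.IsColimit.mk _
      (fun s => biprod.desc (biprod.inl ≫ s.inr) s.inl) ?_ ?_ ?_⟩⟩
  · intro s; simp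
  · intro s
    ext
    · simp
    · simpa using s.condition
  · intro s m h₁ h₂
    ext
    · simp [← h₂]
    · simp [← h₁]

lemma admEpi_map (B : E) {X Y : E} {p : X ⟶ Y}
    (hp : IsAdmissibleEpi ExactCategory.conflation p) :
    IsAdmissibleEpi ExactCategory.conflation (biprod.map p (𝟙 B)) := by
  refine admEpi_of_isPullback (g := biprod.fst) (g' := biprod.fst) hp
    ⟨⟨by simp⟩, ⟨PullbackCone.IsLimit.mk _
      (fun s => biprod.lift s.fst (s.snd ≫ biprod.snd)) ?_ ?_ ?_⟩⟩
  · intro s; simp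
  · intro s
    ext
    · simpa using s.condition
    · simp
  · intro s m h₁ h₂
    ext
    · simp [← h₁]
    · simp [← h₂]

lemma admEpi_desc_id {X Y : E} (g : X ⟶ Y) :
    IsAdmissibleEpi ExactCategory.conflation (biprod.desc (𝟙 Y) g) := by
  refine admEpi_of_isPullback (f := (0 : X ⟶ 0)) (g := (0 : Y ⟶ 0)) (g' := biprod.snd)
    (IsShortExact.zero X (isZero_zero E)).admEpi
    ⟨⟨by simp⟩, ⟨PullbackCone.IsLimit.mk _
      (fun s => biprod.lift (s.snd - s.fst ≫ g) s.fst) ?_ ?_ ?_⟩⟩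
  · intro s; simp
  · intro s; simp
  · intro s m h₁ h₂
    ext
    · simp [← h₁, ← h₂, biprod.desc_eq]
    · simp [← h₁]

lemma admEpi_desc {B Z' Z'' : E} {p : B ⟶ Z''}
    (hp : IsAdmissibleEpi ExactCategory.conflation p) (g : Z' ⟶ Z'') :
    IsAdmissibleEpi ExactCategory.conflation (biprod.desc p g) := by
  have := ExactCategory.comp_epi _ _ (admEpi_map Z' hp) (admEpi_desc_id g)
  convert this using 1
  ext <;> simp

/-- The pullback of an admissible epimorphism gives a short exact sequence. -/
lemma isShortExact_of_isPullback {B Z' Z'' P : E} {p : B ⟶ Z''} {g : Z' ⟶ Z''}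
    {b : P ⟶ B} {z : P ⟶ Z'} (hp : IsAdmissibleEpi ExactCategory.conflation p)
    (h : IsPullback b z p g) : IsShortExact (biprod.lift b (-z)) (biprod.desc p g) := by
  have : Mono (biprod.lift b (-z)) := ⟨fun s t hst => by
    apply h.hom_ext
    · simpa using hst =≫ biprod.fst
    · simpa using hst =≫ biprod.snd⟩
  refine IsShortExact.of_admEpi (admEpi_desc hp g) (by simp [h.w]) (fun t ht => ?_)
  refine ⟨h.lift (t ≫ biprod.fst) (-(t ≫ biprod.snd)) ?_, ?_⟩
  · rw [biprod.desc_eq, Preadditive.comp_add] at ht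
    simpa [eq_neg_iff_add_eq_zero] using ht
  · ext <;> simp

variable {A B ZA ZA' ZB ZB' P : E} {iA : ZA ⟶ A} {pA : A ⟶ ZA'} {iB : ZB ⟶ B} {pB : B ⟶ ZB'}
  {g : ZA ⟶ ZB} {f : A ⟶ B} {g' : ZA' ⟶ ZB'} {b : P ⟶ B} {z : P ⟶ ZA'}
  {k : A ⟶ P} {j : ZB ⟶ P}

/-- A morphism of short exact sequences factors through the pullback of its right square, and the
left square of the factorization gives a short exact sequence. -/
lemma isShortExact_factor (hA : IsShortExact iA pA) (hB : IsShortExact iB pB)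
    (h₁ : iA ≫ f = g ≫ iB) (hP : IsPullback b z pB g')
    (hkb : k ≫ b = f) (hkz : k ≫ z = pA) (hjb : j ≫ b = iB) (hjz : j ≫ z = 0) :
    IsShortExact (biprod.lift iA (-g)) (biprod.desc k j) := by
  have := hB.mono
  have := hA.mono
  have epi : IsAdmissibleEpi ExactCategory.conflation (biprod.desc k j) := by
    have hl : ∀ (s : PullbackCone pA z), ∃ l : s.pt ⟶ ZB, l ≫ iB = (s.snd - s.fst ≫ k) ≫ b :=
      fun s => hB.lift _ (by
        have := s.condition
        simp only [Category.assoc, hP.w, Preadditive.sub_comp, reassoc_of% hkz]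
        rw [reassoc_of% this, sub_self])
    choose l hl using hl
    have hl' : ∀ s, l s ≫ j = s.snd - s.fst ≫ k := fun s => by
      apply hP.hom_ext
      · rw [Category.assoc, hjb, hl]
      · simp [hjz, hkz, s.condition]
    refine admEpi_of_isPullback (g := z) (g' := biprod.fst) hA.admEpi
      ⟨⟨by ext <;> simp [hkz, hjz]⟩, ⟨PullbackCone.IsLimit.mk _
        (fun s => biprod.lift s.fst (l s)) ?_ ?_ ?_⟩⟩
    · intro s; simp
    · intro s; simp [hl']
    · intro s m hm₁ hm₂
      ext
      · simp [← hm₁]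
      · rw [← cancel_mono iB, ← hjb]
        simp only [biprod.lift_snd, reassoc_of% (hl' s), ← hm₁, ← hm₂]
        simp [biprod.desc_eq]
  have : Mono (biprod.lift iA (-g)) := ⟨fun s t hst => by
    rw [← cancel_mono iA]
    simpa using hst =≫ biprod.fst⟩
  refine IsShortExact.of_admEpi epi ?_ (fun t ht => ?_)
  · apply hP.hom_ext
    · simp [hkb, hjb, h₁]
    · simp [hkz, hjz, hA.1]
  · rw [biprod.desc_eq, Preadditive.comp_add] at ht
    have e₁ := ht =≫ z
    have e₂ := ht =≫ b
    simp only [Preadditive.add_comp, Category.assoc, hkz, hjz, hkb, hjb, comp_zero, zero_comp,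
      add_zero] at e₁ e₂
    obtain ⟨c, hc⟩ := hA.lift (t ≫ biprod.fst) (by simpa using e₁)
    refine ⟨c, ?_⟩
    ext
    · simpa using hc
    · rw [← cancel_mono iB]
      rw [← Category.assoc t, ← hc, Category.assoc, h₁] at e₂
      simp only [Category.assoc, biprod.lift_snd, Preadditive.comp_neg, Preadditive.neg_comp]
      exact neg_eq_of_add_eq_zero_right e₂

/-- The short exact sequence in one degree of a mapping cone. -/
lemma isShortExact_cone {A' ZA'' P' : E} {iA' : ZA' ⟶ A'} {pA' : A' ⟶ ZA''}
    {k' : A' ⟶ P'} {j' : ZB' ⟶ P'} (hA' : IsShortExact iA' pA') (hB : IsShortExact iB pB)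
    (hP : IsPullback b z pB g')
    (h : IsShortExact (biprod.lift iA' (-g')) (biprod.desc k' j')) :
    IsShortExact (biprod.lift b (-z ≫ iA')) (biprod.desc (pB ≫ j') k') := by
  have hPB := isShortExact_of_isPullback hB.admEpi hP
  have mono := ExactCategory.comp_mono _ _ hPB.admMono (admMono_map B hA'.admMono)
  have e : biprod.lift b (-z) ≫ biprod.map (𝟙 B) iA' = biprod.lift b (-z ≫ iA') := by
    ext <;> simp
  rw [e] at mono
  have w : iA' ≫ k' = g' ≫ j' := by
    have := h.1
    simpa [add_neg_eq_zero] using this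
  have := hB.epi
  have := h.epi
  have : Epi (biprod.desc (pB ≫ j') k') := ⟨fun s t hst => by
    rw [← cancel_epi (biprod.desc k' j')]
    ext
    · simpa using biprod.inr ≫= hst
    · rw [← cancel_epi pB]
      simpa using biprod.inl ≫= hst⟩
  refine IsShortExact.of_admMono mono (by simp [w, ← reassoc_of% hP.w]) (fun t ht => ?_)
  rw [biprod.lift_eq, Preadditive.add_comp] at ht
  obtain ⟨c, hc⟩ := hPB.desc (biprod.desc (biprod.inl ≫ t) (iA' ≫ biprod.inr ≫ t)) (by
    simpa using ht)
  have hc₁ : pB ≫ biprod.inl ≫ biprod.desc (𝟙 _) g' ≫ c = biprod.inl ≫ t := by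
    simpa using biprod.inl ≫= hc
  have hc₂ : g' ≫ c = iA' ≫ biprod.inr ≫ t := by
    simpa using biprod.inr ≫= hc
  obtain ⟨l, hl⟩ := h.desc (biprod.desc (biprod.inr ≫ t) c) (by simp [hc₂])
  have hl₁ : k' ≫ l = biprod.inr ≫ t := by simpa using biprod.inl ≫= hl
  have hl₂ : j' ≫ l = c := by simpa using biprod.inr ≫= hl
  refine ⟨l, ?_⟩
  ext
  · simpa [hl₂] using hc₁
  · simpa using hl₁

/-- A cochain complex `N` over an exact category is acyclic if its differentials factor as
`N^n ↠ Z^{n+1} ↣ N^{n+1}` in such a way that every `Z^n ↣ N^n ↠ Z^{n+1}` is a short exact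
sequence. -/
def IsAcyclic (N : CochainComplex E ℤ) : Prop :=
  ∃ (Z : ℤ → E) (i : ∀ n, Z n ⟶ N.X n) (p : ∀ n, N.X n ⟶ Z (n + 1)),
    ∀ n, N.d n (n + 1) = p n ≫ i (n + 1) ∧ IsShortExact (i n) (p n)

lemma isAcyclic_iff (N : CochainComplex E ℤ) :
    IsAcyclic N ↔ ∃ (Z : ℤ → E) (i : ∀ n, Z n ⟶ N.X n) (p : ∀ n m, n + 1 = m → (N.X n ⟶ Z m)),
      ∀ n m (h : n + 1 = m), N.d n m = p n m h ≫ i m ∧ IsShortExact (i n) (p n m h) := by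
  constructor
  · rintro ⟨Z, i, p, hp⟩
    refine ⟨Z, i, fun n m h => p n ≫ eqToHom (by rw [h]), ?_⟩
    rintro n _ rfl
    simpa using hp n
  · rintro ⟨Z, i, p, hp⟩
    exact ⟨Z, i, fun n => p n _ rfl, fun n => hp n _ rfl⟩

lemma isAcyclic_zero {N : CochainComplex E ℤ} (hN : ∀ n, IsZero (N.X n)) : IsAcyclic N := by
  refine ⟨N.X, fun n => 𝟙 _, fun n => 0, fun n => ⟨(hN n).eq_of_src _ _, ?_⟩⟩
  exact IsShortExact.zero _ (hN _)

lemma isAcyclic_shift {N : CochainComplex E ℤ} (hN : IsAcyclic N) (a : ℤ) :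
    IsAcyclic (N⟦a⟧) := by
  rw [isAcyclic_iff] at hN ⊢
  obtain ⟨Z, i, p, h⟩ := hN
  refine ⟨fun n => Z (n + a), fun n => i (n + a),
    fun n m hnm => a.negOnePow • p (n + a) (m + a) (by omega), fun n m hnm => ⟨?_, ?_⟩⟩
  · have h' := (h (n + a) (m + a) (by omega)).1
    have h'' : a.negOnePow • N.d (n + a) (m + a) =
        (a.negOnePow • p (n + a) (m + a) (by omega)) ≫ i (m + a) := by
      rw [Linear.units_smul_comp, h']
    exact h''
  · have h' := (h (n + a) (m + a) (by omega)).2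
    let e : Z (m + a) ≅ Z (m + a) := a.negOnePow • Iso.refl _
    refine h'.of_iso (Iso.refl _) (Iso.refl _) e ?_ ?_
    · exact (Category.comp_id _).trans (Category.id_comp _).symm
    · simp [e]

lemma isAcyclic_mappingCone {K L : CochainComplex E ℤ} (φ : K ⟶ L) (hK : IsAcyclic K)
    (hL : IsAcyclic L) : IsAcyclic (CochainComplex.mappingCone φ) := by
  obtain ⟨ZK, iK, pK, hK⟩ := hK
  obtain ⟨ZL, iL, pL, hL⟩ := hL
  have hg : ∀ n, ∃ g : ZK n ⟶ ZL n, iK n ≫ φ.f n = g ≫ iL n := fun n => by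
    have := (hL (n + 1)).2.mono
    obtain ⟨g, hg⟩ := (hL n).2.lift (iK n ≫ φ.f n) (by
      rw [← cancel_mono (iL (n + 1)), Category.assoc, Category.assoc, ← (hL n).1,
        φ.comm, (hK n).1, Category.assoc, reassoc_of% (hK n).2.1]
      simp)
    exact ⟨g, hg.symm⟩
  choose g hg using hg
  have hg' : ∀ n, pK n ≫ g (n + 1) = φ.f n ≫ pL n := fun n => by
    have := (hL (n + 1)).2.mono
    rw [← cancel_mono (iL (n + 1)), Category.assoc, Category.assoc, ← hg, ← (hL n).1,
      φ.comm, (hK n).1, Category.assoc]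
  choose P b z hP hz using fun n => ExactCategory.pullback (pL n) (g (n + 1)) (hL n).2.admEpi
  let k : ∀ n, K.X n ⟶ P n := fun n => (hP n).lift (φ.f n) (pK n) (hg' n).symm
  let j : ∀ n, ZL n ⟶ P n := fun n => (hP n).lift (iL n) 0 (by simp [(hL n).2.1])
  have hf : ∀ n, IsShortExact (biprod.lift (iK n) (-g n)) (biprod.desc (k n) (j n)) := fun n =>
    isShortExact_factor (hK n).2 (hL n).2 (hg n) (hP n) (by simp [k]) (by simp [k])
      (by simp [j]) (by simp [j])
  have hc := fun n => isShortExact_cone (hK (n + 1)).2 (hL n).2 (hP n) (hf (n + 1))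
  let e : ∀ n, L.X n ⊞ K.X (n + 1) ≅ (CochainComplex.mappingCone φ).X n := fun n =>
    { hom := biprod.desc ((CochainComplex.mappingCone.inr φ).f n)
        ((CochainComplex.mappingCone.inl φ).v (n + 1) n (by omega))
      inv := biprod.lift ((CochainComplex.mappingCone.snd φ).v n n (add_zero n))
        ((CochainComplex.mappingCone.fst φ).1.v n (n + 1) rfl)
      hom_inv_id := by ext <;> simp
      inv_hom_id := by
        apply CochainComplex.mappingCone.ext_from φ (n + 1) n rfl <;> simp }
  refine ⟨P, fun n => biprod.lift (b n) (-z n ≫ iK (n + 1)) ≫ (e n).hom,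
    fun n => (e n).inv ≫ biprod.desc (pL n ≫ j (n + 1)) (k (n + 1)), fun n => ⟨?_, ?_⟩⟩
  · apply CochainComplex.mappingCone.ext_from φ (n + 1) n rfl
    · rw [CochainComplex.mappingCone.inl_v_d φ (n + 1) n (n + 1 + 1) (by omega) (by omega)]
      simp [e, k, j, (hK (n + 1)).1, sub_eq_add_neg]
    · rw [(CochainComplex.mappingCone.inr φ).comm]
      simp [e, k, j, (hL n).1]
  · exact (hc n).of_iso (Iso.refl _) (e n) (Iso.refl _) (by simp) (by simp)

end ExactCategories

section DerivedCategory

/-- The cochain complexes in the homotopy category whose terms vanish in all but finitely many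
degrees. -/
def bounded (E : Type u) [Category.{v} E] [Preadditive E] :
    ObjectProperty (HomotopyCategory E (ComplexShape.up ℤ)) :=
  fun K => ∃ a b : ℤ, ∀ n : ℤ, (n < a ∨ b < n) → IsZero (K.as.X n)

variable (E : Type u) [Category.{v} E] [Preadditive E] [HasZeroObject E] [HasBinaryBiproducts E]

instance : (bounded E).ContainsZero where
  exists_zero :=
    ⟨(HomotopyCategory.quotient _ _).obj 0, Functor.map_isZero _ (isZero_zero _),
      0, 0, fun n _ => (HomologicalComplex.eval E _ n).map_isZero (isZero_zero _)⟩

instance : (bounded E).IsStableUnderShift ℤ where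
  isStableUnderShiftBy a :=
    { le_shift := by
        intro K hK
        obtain ⟨K, rfl⟩ := HomotopyCategory.quotient_obj_surjective K
        obtain ⟨x, y, h⟩ := hK
        rw [ObjectProperty.prop_shift_iff, HomotopyCategory.shift_quotient_obj]
        exact ⟨x - a, y - a, fun n hn => h (n + a) (by omega)⟩ }

instance : (bounded E).IsTriangulatedClosed₃ where
  ext₃' T hT := by
    rintro ⟨a₁, b₁, h₁⟩ ⟨a₂, b₂, h₂⟩
    obtain ⟨f : T.obj₁.as ⟶ T.obj₂.as, hf⟩ :=
      (HomotopyCategory.quotient _ _).map_surjective T.mor₁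
    refine ⟨(HomotopyCategory.quotient _ _).obj (CochainComplex.mappingCone f),
      ⟨min (a₁ - 1) a₂, max b₁ b₂, fun n hn => ?_⟩,
      ⟨Triangle.π₃.mapIso (isoTriangleOfIso₁₂ T _ hT
        (HomotopyCategory.mappingCone_triangleh_distinguished f)
        (Iso.refl _) (Iso.refl _) ?_)⟩⟩
    · exact (CochainComplex.mappingCone.isZero_X_iff f n).2
        ⟨h₁ _ (by omega), h₂ _ (by omega)⟩
    · exact (Category.comp_id _).trans (hf.symm.trans (Category.id_comp _).symm)

instance : (bounded E).IsTriangulated where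
  toIsTriangulatedClosed₂ := .of_isTriangulatedClosed₃

/-- The bounded homotopy category `K^b(E)`, with its usual triangulated structure. -/
abbrev BoundedHomotopyCategory := (bounded E).FullSubcategory

/-- The canonical functor `E ⥤ K^b(E)`, sending an object to the complex concentrated in degree
zero. -/
noncomputable def toBoundedHomotopyCategory : E ⥤ BoundedHomotopyCategory E :=
  (bounded E).lift (HomotopyCategory.singleFunctor E 0)
    (fun X => ⟨0, 0, fun n hn =>
      HomologicalComplex.isZero_single_obj_X (ComplexShape.up ℤ) 0 X n (by omega)⟩)

variable [ExactCategory E]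

/-- The objects of `K^b(E)` which are isomorphic in `K^b(E)` to an acyclic complex. -/
def acyclicComplexes : ObjectProperty (BoundedHomotopyCategory E) :=
  ObjectProperty.isoClosure fun K => IsAcyclic K.obj.as

instance : (acyclicComplexes E).IsClosedUnderIsomorphisms := by
  unfold acyclicComplexes
  infer_instance

instance : (acyclicComplexes E).ContainsZero where
  exists_zero := by
    refine ⟨⟨(HomotopyCategory.quotient _ _).obj 0, 0, 0,
      fun n _ => (HomologicalComplex.eval E _ n).map_isZero (isZero_zero _)⟩, ?_,
      ObjectProperty.le_isoClosure _ _
        (isAcyclic_zero fun n => (HomologicalComplex.eval E _ n).map_isZero (isZero_zero _))⟩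
    rw [IsZero.iff_id_eq_zero]
    ext
    exact (Functor.map_isZero (HomotopyCategory.quotient E _) (isZero_zero _)).eq_of_src _ _

instance : (acyclicComplexes E).IsStableUnderShift ℤ where
  isStableUnderShiftBy a :=
    { le_shift := by
        rintro K ⟨M, hM, ⟨e⟩⟩
        have hb := (bounded E).le_shift a _ M.property
        have hM' : IsAcyclic ((HomotopyCategory.quotient E (ComplexShape.up ℤ)).obj
          ((show CochainComplex E ℤ from M.obj.as)⟦a⟧)).as := isAcyclic_shift hM a
        rw [← HomotopyCategory.shift_quotient_obj] at hM'
        exact ⟨⟨M.obj⟦a⟧, hb⟩, hM', ⟨(shiftFunctor _ a).mapIso e ≪≫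
          (bounded E).fullyFaithfulι.preimageIso (((bounded E).ι.commShiftIso a).app M)⟩⟩ }

instance : (acyclicComplexes E).IsTriangulatedClosed₃ := .mk' (by
    rintro T hT ⟨M₁, h₁, ⟨e₁⟩⟩ ⟨M₂, h₂, ⟨e₂⟩⟩
    obtain ⟨f : M₁.obj.as ⟶ M₂.obj.as, hf⟩ :=
      (HomotopyCategory.quotient _ _).map_surjective (e₁.inv ≫ T.mor₁ ≫ e₂.hom).hom
    have hT' := (bounded E).ι.map_distinguished _ hT
    have := isAcyclic_mappingCone f h₁ h₂
    obtain ⟨a₁, b₁, h₁⟩ := M₁.property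
    obtain ⟨a₂, b₂, h₂⟩ := M₂.property
    let C : BoundedHomotopyCategory E :=
      ⟨(HomotopyCategory.quotient _ _).obj (CochainComplex.mappingCone f),
        min (a₁ - 1) a₂, max b₁ b₂, fun n hn =>
          (CochainComplex.mappingCone.isZero_X_iff f n).2 ⟨h₁ _ (by omega), h₂ _ (by omega)⟩⟩
    refine ⟨C, this, ⟨(bounded E).fullyFaithfulι.preimageIso
      (Triangle.π₃.mapIso (isoTriangleOfIso₁₂ _ _ hT'
        (HomotopyCategory.mappingCone_triangleh_distinguished f)
        ((bounded E).ι.mapIso e₁) ((bounded E).ι.mapIso e₂) ?_))⟩⟩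
    have h : T.mor₁ ≫ e₂.hom = e₁.hom ≫ (e₁.inv ≫ T.mor₁ ≫ e₂.hom) := by simp
    exact ((bounded E).ι.congr_map h).trans
      (congrArg (fun t => e₁.hom.hom ≫ t) hf.symm))

instance : (acyclicComplexes E).IsTriangulated where
  toIsTriangulatedClosed₂ := .of_isTriangulatedClosed₃

/-- The bounded derived category `D^b(E)`: the Verdier quotient of `K^b(E)` by the full
triangulated subcategory of the objects isomorphic in `K^b(E)` to acyclic complexes. -/
abbrev BoundedDerivedCategory := (acyclicComplexes E).trW.Localization

/-- The canonical functor `E ⥤ D^b(E)`. -/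
noncomputable def toBoundedDerivedCategory : E ⥤ BoundedDerivedCategory E :=
  toBoundedHomotopyCategory E ⋙ (acyclicComplexes E).trW.Q

end DerivedCategory

section GrothendieckGroups

/-- The type of isomorphism classes of objects of a category. -/
abbrev IsoClass (C : Type u) [Category.{v} C] : Type u := Quotient (isIsomorphicSetoid C)

/-- The generator of the free abelian group on isomorphism classes given by an object. -/
def isoClassOf {C : Type u} [Category.{v} C] (X : C) : FreeAbelianGroup (IsoClass C) :=
  FreeAbelianGroup.of (Quotient.mk _ X)

/-- The Grothendieck group of an exact category: the free abelian group on isomorphism classes of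
objects modulo the relations `[A] - [B] + [C] = 0` for all short exact sequences `A ↣ B ↠ C`. -/
abbrev ExactK0 (E : Type u) [Category.{v} E] [Preadditive E] [HasZeroObject E]
    [HasBinaryBiproducts E] [ExactCategory E] : Type u :=
  FreeAbelianGroup (IsoClass E) ⧸ AddSubgroup.closure
    {x | ∃ (A B C : E) (f : A ⟶ B) (g : B ⟶ C), IsShortExact f g ∧
      x = isoClassOf A - isoClassOf B + isoClassOf C}

/-- The Grothendieck group of a triangulated category: the free abelian group on isomorphism
classes of objects modulo the relations `[A] - [B] + [C] = 0` for all exact triangles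
`A ⟶ B ⟶ C ⟶ A[1]`. -/
abbrev TriangulatedK0 (T : Type u) [Category.{v} T] [Preadditive T] [HasZeroObject T]
    [HasShift T ℤ] [∀ n : ℤ, (shiftFunctor T n).Additive] [Pretriangulated T] : Type u :=
  FreeAbelianGroup (IsoClass T) ⧸ AddSubgroup.closure
    {x | ∃ Δ : Triangle T, Δ ∈ (distTriang T) ∧
      x = isoClassOf Δ.obj₁ - isoClassOf Δ.obj₂ + isoClassOf Δ.obj₃}

/-- The class `[X]` of an object in the Grothendieck group of an exact category. -/
def ExactK0.mk {E : Type u} [Category.{v} E] [Preadditive E] [HasZeroObject E]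
    [HasBinaryBiproducts E] [ExactCategory E] (X : E) : ExactK0 E :=
  QuotientAddGroup.mk (isoClassOf X)

/-- The class `[X]` of an object in the Grothendieck group of a triangulated category. -/
def TriangulatedK0.mk {T : Type u} [Category.{v} T] [Preadditive T] [HasZeroObject T]
    [HasShift T ℤ] [∀ n : ℤ, (shiftFunctor T n).Additive] [Pretriangulated T] (X : T) :
    TriangulatedK0 T :=
  QuotientAddGroup.mk (isoClassOf X)

end GrothendieckGroups

end ExactCat

/-! The inverse of `φ` is the Euler characteristic, sending a bounded complex `K` to the alternating
sum of the classes of its terms in `K₀(E)`. The two composites are identities because a complex in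
degree zero has itself as Euler characteristic, and because brutal truncation writes the class of
`K` in `K₀(D^b(E))` as the alternating sum of the classes of its terms
(`complexClass_eq_eulerChar`). The latter, applied to a short exact sequence viewed as an acyclic
complex, also shows that `φ` is well defined.

The real content is that the Euler characteristic depends only on the object of `D^b(E)`. It is
additive on mapping cones, so a calculus of fractions reduces this to its vanishing on complexes
that become zero in `D^b(E)`. Such a complex is only known to be a retract, up to homotopy, of a
bounded acyclic complex `N` (`exists_retract_of_isZero_Q_obj`). Adding a contractible complex to `N`
makes the retraction strict. By weak idempotent completeness a retract of an admissible monomorphism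
is an admissible monomorphism (`exists_isShortExact_of_retract`). Working upwards degree by degree,
the retract therefore splits into short exact sequences, and its Euler characteristic telescopes to
zero. -/

namespace ExactCat

/-! ### Retracts of admissible monomorphisms under weak idempotent completeness. -/

section WeaklyIdempotentComplete

variable {E : Type u} [Category.{v} E] [Preadditive E] [HasZeroObject E]
  [HasBinaryBiproducts E] [ExactCategory E]

lemma isShortExact_biprod (X Y : E) :
    IsShortExact (biprod.inr : Y ⟶ X ⊞ Y) (biprod.fst : X ⊞ Y ⟶ X) := by
  refine IsShortExact.of_admEpi ?_ (by simp) (fun t ht => ⟨t ≫ biprod.snd, ?_⟩)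
  · convert admEpi_desc_id (0 : Y ⟶ X)
    ext <;> simp
  · ext
    · simpa using ht.symm
    · simp

/-- A section with a cokernel is an admissible monomorphism. -/
lemma admMono_of_retraction {X Y : E} (i : X ⟶ Y) (r : Y ⟶ X) (h : i ≫ r = 𝟙 X)
    [HasCokernel i] : IsAdmissibleMono ExactCategory.conflation i := by
  -- The idempotent `𝟙 Y - r ≫ i` kills `i`, so it descends to a section of the cokernel projection;
  -- this splits `Y` as `cokernel i ⊞ X`.
  let s : cokernel i ⟶ Y := cokernel.desc i (𝟙 Y - r ≫ i) (by simp [reassoc_of% h])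
  have hs : cokernel.π i ≫ s = 𝟙 Y - r ≫ i := cokernel.π_desc _ _ _
  have hs₁ : s ≫ cokernel.π i = 𝟙 _ := by
    rw [← cancel_epi (cokernel.π i), reassoc_of% hs]
    simp
  have hs₂ : s ≫ r = 0 := by
    rw [← cancel_epi (cokernel.π i), reassoc_of% hs]
    simp [h]
  let e : cokernel i ⊞ X ≅ Y :=
    { hom := biprod.desc s i
      inv := biprod.lift (cokernel.π i) r
      hom_inv_id := by ext <;> simp [h, hs₁, hs₂]
      inv_hom_id := by simp [hs] }
  exact ((isShortExact_biprod (cokernel i) X).of_iso (g' := e.inv ≫ biprod.fst)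
    (Iso.refl _) e (Iso.refl _) (by simp [e]) (by simp)).admMono

/-- In a weakly idempotent complete exact category, a retract of an admissible monomorphism is
an admissible monomorphism, and its cokernel is a retract. -/
lemma exists_isShortExact_of_retract (hE : IsWeaklyIdempotentComplete E) {A B C A' B' : E}
    {i : A ⟶ B} {p : B ⟶ C} (h : IsShortExact i p) (i' : A' ⟶ B')
    {a : A' ⟶ A} {ra : A ⟶ A'} (ha : a ≫ ra = 𝟙 A')
    {b : B' ⟶ B} {rb : B ⟶ B'} (hb : b ≫ rb = 𝟙 B')
    (w₁ : i' ≫ b = a ≫ i) (w₂ : i ≫ rb = ra ≫ i') :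
    ∃ (C' : E) (p' : B' ⟶ C') (c : C' ⟶ C) (rc : C ⟶ C'), IsShortExact i' p' ∧
      c ≫ rc = 𝟙 C' ∧ p' ≫ c = b ≫ p ∧ p ≫ rc = rb ≫ p' := by
  have := (hE ra a ha).2
  have := (hE rb b hb).2
  have hm : IsAdmissibleMono ExactCategory.conflation (i' ≫ b) := by
    rw [w₁]
    exact ExactCategory.comp_mono _ _ (admMono_of_retraction a ra ha) h.admMono
  obtain ⟨D, q, wq, hq⟩ := hm
  have hq : IsShortExact (i' ≫ b) q := ⟨wq, hq⟩
  let β := cokernel.π b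
  have hbβ : b ≫ β = 0 := cokernel.condition b
  let σ : cokernel b ⟶ B := cokernel.desc b (𝟙 B - rb ≫ b) (by simp [reassoc_of% hb])
  have hσ : β ≫ σ = 𝟙 B - rb ≫ b := cokernel.π_desc _ _ _
  have hσ₁ : σ ≫ β = 𝟙 _ := by
    rw [← cancel_epi (cokernel.π b), reassoc_of% hσ]
    simp [β]
  -- `δ` has the section `σ ≫ q`, so weak idempotent completeness provides its kernel, which serves
  -- as `C'`.
  obtain ⟨δ, hδ⟩ := hq.desc β (by simp [hbβ])
  have := (hE δ (σ ≫ q) (by rw [Category.assoc, hδ, hσ₁])).1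
  let κ := kernel.ι δ
  let p' : B' ⟶ kernel δ := kernel.lift δ (b ≫ q) (by rw [Category.assoc, hδ, hbβ])
  have hp' : p' ≫ κ = b ≫ q := kernel.lift_ι _ _ _
  -- A map to `B` whose image in `D` lies in `kernel δ` dies in `cokernel b`, hence factors through
  -- `b`. So `p'` is a pullback of the admissible epimorphism `q`.
  have hpb : IsPullback b p' q κ := by
    have key : ∀ s : PullbackCone q κ, s.fst ≫ rb ≫ b = s.fst := fun s => by
      have h₀ : s.fst ≫ β = 0 := by
        rw [← hδ, reassoc_of% s.condition, kernel.condition, comp_zero]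
      have := h₀ =≫ σ
      rw [Category.assoc, hσ] at this
      rw [Preadditive.comp_sub, Category.comp_id, zero_comp, sub_eq_zero] at this
      exact this.symm
    refine ⟨⟨hp'.symm⟩, ⟨PullbackCone.IsLimit.mk _ (fun s => s.fst ≫ rb) ?_ ?_ ?_⟩⟩
    · intro s
      simpa using key s
    · intro s
      rw [← cancel_mono κ]
      simp only [Category.assoc, hp']
      rw [reassoc_of% (key s), s.condition]
    · intro s m hm _
      rw [← hm, Category.assoc, hb, Category.comp_id]
  have hb_mono : Mono b := mono_of_mono_fac hb
  have hi' : Mono i' := by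
    have := hq.mono
    exact mono_of_mono i' b
  have hS : IsShortExact i' p' := by
    refine IsShortExact.of_admEpi (admEpi_of_isPullback hq.admEpi hpb) ?_ (fun t ht => ?_)
    · rw [← cancel_mono κ, Category.assoc, hp', ← Category.assoc, hq.1, zero_comp]
    · obtain ⟨l, hl⟩ := hq.lift (t ≫ b) (by
        rw [Category.assoc, ← hp', reassoc_of% ht, zero_comp])
      exact ⟨l, by rw [← cancel_mono b, Category.assoc, hl]⟩
  have := hS.epi
  obtain ⟨c, hc⟩ := hS.desc (b ≫ p) (by rw [reassoc_of% w₁, h.1, comp_zero])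
  obtain ⟨rc, hrc⟩ := h.desc (rb ≫ p') (by rw [reassoc_of% w₂, hS.1, comp_zero])
  refine ⟨_, p', c, rc, hS, ?_, hc, hrc⟩
  rw [← cancel_epi p', reassoc_of% hc, hrc, reassoc_of% hb, Category.comp_id]

end WeaklyIdempotentComplete

end ExactCat

namespace ExactCat

/-! ### Direct sums of short exact sequences. -/

section Biproducts

variable {E : Type u} [Category.{v} E] [Preadditive E] [HasZeroObject E]
  [HasBinaryBiproducts E] [ExactCategory E]

lemma admEpi_map_id (B : E) {X Y : E} {p : X ⟶ Y}
    (hp : IsAdmissibleEpi ExactCategory.conflation p) :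
    IsAdmissibleEpi ExactCategory.conflation (biprod.map (𝟙 B) p) := by
  refine admEpi_of_isPullback (g := biprod.snd) (g' := biprod.snd) hp
    ⟨⟨by simp⟩, ⟨PullbackCone.IsLimit.mk _
      (fun s => biprod.lift (s.snd ≫ biprod.fst) s.fst) ?_ ?_ ?_⟩⟩
  · intro s; simp
  · intro s
    ext
    · simp
    · simpa using s.condition
  · intro s m h₁ h₂
    ext
    · simp [← h₂]
    · simp [← h₁]

/-- The direct sum of two short exact sequences is a short exact sequence. -/
lemma IsShortExact.biprod_map {A B C A' B' C' : E} {i : A ⟶ B} {p : B ⟶ C} {i' : A' ⟶ B'}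
    {p' : B' ⟶ C'} (h : IsShortExact i p) (h' : IsShortExact i' p') :
    IsShortExact (biprod.map i i') (biprod.map p p') := by
  have := h.mono
  have := h'.mono
  have : Mono (biprod.map i i') := ⟨fun s t hst => by
    ext
    · rw [← cancel_mono i]
      simpa using hst =≫ biprod.fst
    · rw [← cancel_mono i']
      simpa using hst =≫ biprod.snd⟩
  refine of_admEpi ?_ (by ext <;> simp [h.1, h'.1]) (fun t ht => ?_)
  · have := ExactCategory.comp_epi _ _ (admEpi_map B' h.admEpi) (admEpi_map_id C h'.admEpi)
    convert this using 1
    ext <;> simp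
  · obtain ⟨l, hl⟩ := h.lift (t ≫ biprod.fst) (by simpa using ht =≫ biprod.fst)
    obtain ⟨l', hl'⟩ := h'.lift (t ≫ biprod.snd) (by simpa using ht =≫ biprod.snd)
    exact ⟨biprod.lift l l', by ext <;> simp [hl, hl']⟩

lemma isShortExact_inl_snd (X Y : E) :
    IsShortExact (biprod.inl : X ⟶ X ⊞ Y) (biprod.snd : X ⊞ Y ⟶ Y) :=
  (isShortExact_biprod Y X).of_iso (Iso.refl _) (biprod.braiding _ _) (Iso.refl _)
    (by ext <;> simp) (by simp)

end Biproducts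

/-! ### Elementary relations in the two Grothendieck groups. -/

section ExactK0

variable {E : Type u} [Category.{v} E] [Preadditive E] [HasZeroObject E]
  [HasBinaryBiproducts E] [ExactCategory E]

namespace ExactK0

lemma mk_eq_add {A B C : E} {f : A ⟶ B} {g : B ⟶ C} (h : IsShortExact f g) :
    mk B = mk A + mk C := by
  have : (QuotientAddGroup.mk (isoClassOf A - isoClassOf B + isoClassOf C) : ExactK0 E) = 0 :=
    (QuotientAddGroup.eq_zero_iff _).2 (AddSubgroup.subset_closure ⟨A, B, C, f, g, h, rfl⟩)
  have : mk A - mk B + mk C = 0 := this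
  rw [← sub_eq_zero, ← neg_eq_zero, ← this]
  abel

lemma mk_eq_of_iso {A B : E} (e : A ≅ B) : mk A = mk B :=
  congrArg (fun x : IsoClass E => (QuotientAddGroup.mk (FreeAbelianGroup.of x) : ExactK0 E))
    (Quotient.sound ⟨e⟩)

lemma mk_eq_zero {A : E} (hA : IsZero A) : mk A = 0 := by
  simpa using mk_eq_add (IsShortExact.zero A hA)

lemma mk_biprod (A B : E) : mk (A ⊞ B) = mk A + mk B :=
  mk_eq_add (isShortExact_inl_snd A B)

end ExactK0

end ExactK0

section TriangulatedK0

variable {T : Type u} [Category.{v} T] [Preadditive T] [HasZeroObject T]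
  [HasShift T ℤ] [∀ n : ℤ, (shiftFunctor T n).Additive] [Pretriangulated T]

namespace TriangulatedK0

lemma mk_eq_add {Δ : Triangle T} (h : Δ ∈ distTriang T) :
    mk Δ.obj₂ = mk Δ.obj₁ + mk Δ.obj₃ := by
  have : (QuotientAddGroup.mk
      (isoClassOf Δ.obj₁ - isoClassOf Δ.obj₂ + isoClassOf Δ.obj₃) : TriangulatedK0 T) = 0 :=
    (QuotientAddGroup.eq_zero_iff _).2 (AddSubgroup.subset_closure ⟨Δ, h, rfl⟩)
  have : mk Δ.obj₁ - mk Δ.obj₂ + mk Δ.obj₃ = 0 := this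
  rw [← sub_eq_zero, ← neg_eq_zero, ← this]
  abel

lemma mk_eq_of_iso {A B : T} (e : A ≅ B) : mk A = mk B :=
  congrArg (fun x : IsoClass T => (QuotientAddGroup.mk (FreeAbelianGroup.of x) : TriangulatedK0 T))
    (Quotient.sound ⟨e⟩)

lemma mk_eq_zero {A : T} (hA : IsZero A) : mk A = 0 := by
  have : mk A = mk A + mk (0 : T) := mk_eq_add (contractible_distinguished A)
  rw [left_eq_add] at this
  rw [← this]
  exact mk_eq_of_iso (hA.iso (isZero_zero T))

/-- Rotating the contractible triangle gives a triangle `A ⟶ 0 ⟶ A⟦1⟧`. -/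
lemma mk_shift_one (A : T) : mk (A⟦(1 : ℤ)⟧) = - mk A := by
  have : mk (0 : T) = mk A + mk (A⟦(1 : ℤ)⟧) :=
    mk_eq_add (rot_of_distTriang _ (contractible_distinguished A))
  rw [mk_eq_zero (isZero_zero T)] at this
  exact (neg_eq_of_add_eq_zero_right this.symm).symm

lemma mk_shift (A : T) (n : ℤ) : mk (A⟦n⟧) = n.negOnePow • mk A := by
  have h : ∀ n : ℤ, mk (A⟦n + 1⟧) = - mk (A⟦n⟧) := fun n => by
    rw [← mk_shift_one]
    exact mk_eq_of_iso ((shiftFunctorAdd T n 1).app A)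
  induction n with
  | zero => simpa using mk_eq_of_iso ((shiftFunctorZero T ℤ).app A)
  | succ n hn => rw [h, hn, Int.negOnePow_succ, Units.neg_smul]
  | pred n hn =>
    have := h (-(n : ℤ) - 1)
    rw [sub_add_cancel, hn] at this
    rw [← neg_neg (mk (A⟦-(n : ℤ) - 1⟧)), ← this, Int.negOnePow_sub, Int.negOnePow_one]
    simp

end TriangulatedK0

end TriangulatedK0

end ExactCat

namespace ExactCat

/-! ### Euler characteristics and mapping cones. -/

section EulerCharacteristic

variable {E : Type u} [Category.{v} E] {M : Type*} [AddCommGroup M]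

lemma hasFiniteSupport_of_isZero {m : E → M} (hm : ∀ X, IsZero X → m X = 0) {K : ℤ → E} {a b : ℤ}
    (hK : ∀ n, (n < a ∨ b < n) → IsZero (K n)) :
    (fun n : ℤ => n.negOnePow • m (K n)).HasFiniteSupport := by
  refine (Set.finite_Icc a b).subset (fun n hn => ?_)
  by_contra h
  refine hn ?_
  rw [Set.mem_Icc, not_and_or, not_le, not_le] at h
  simp only [hm _ (hK n h), smul_zero]

variable [Preadditive E]

/-- The alternating sum of the values of a function on objects at the terms of a complex. -/
noncomputable def eulerChar (m : E → M) (K : CochainComplex E ℤ) : M :=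
  ∑ᶠ n : ℤ, n.negOnePow • m (K.X n)

variable {m : E → M}

lemma eulerChar_eq_sum_range (hm : ∀ X, IsZero X → m X = 0) {K : CochainComplex E ℤ} (a : ℤ)
    (k : ℕ) (hK : ∀ n, (n < a ∨ a + k ≤ n) → IsZero (K.X n)) :
    eulerChar m K = ∑ j ∈ Finset.range k, (a + j).negOnePow • m (K.X (a + j)) := by
  have hs : Function.support (fun n : ℤ => n.negOnePow • m (K.X n)) ⊆
      ((Finset.range k).image (fun j : ℕ => a + j) : Finset ℤ) := by
    intro n hn
    by_contra h
    refine hn ?_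
    have : n < a ∨ a + k ≤ n := by
      by_contra! h'
      refine h ?_
      rw [Finset.coe_image]
      exact ⟨(n - a).toNat, by simp; omega, by simp; omega⟩
    simp only [hm _ (hK n this), smul_zero]
  rw [eulerChar, finsum_eq_sum_of_support_subset _ hs, Finset.sum_image (by simp)]

variable [HasBinaryBiproducts E]

lemma eulerChar_mappingCone (hm : ∀ X, IsZero X → m X = 0) (hm' : ∀ X Y, (X ≅ Y) → m X = m Y)
    (hm₂ : ∀ X Y, m (X ⊞ Y) = m X + m Y) {K L : CochainComplex E ℤ}
    (hK : bounded E ((HomotopyCategory.quotient _ _).obj K))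
    (hL : bounded E ((HomotopyCategory.quotient _ _).obj L)) (f : K ⟶ L) :
    eulerChar m (CochainComplex.mappingCone f) = eulerChar m L - eulerChar m K := by
  obtain ⟨a, b, hK⟩ := hK
  obtain ⟨c, d, hL⟩ := hL
  have e : ∀ n, m ((CochainComplex.mappingCone f).X n) = m (L.X n) + m (K.X (n + 1)) := fun n => by
    rw [← hm₂]
    exact hm' _ _
      { hom := biprod.lift ((CochainComplex.mappingCone.snd f).v n n (add_zero n))
          ((CochainComplex.mappingCone.fst f).1.v n (n + 1) rfl)
        inv := biprod.desc ((CochainComplex.mappingCone.inr f).f n)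
          ((CochainComplex.mappingCone.inl f).v (n + 1) n (by omega))
        hom_inv_id := by
          apply CochainComplex.mappingCone.ext_from f (n + 1) n rfl <;> simp
        inv_hom_id := by ext <;> simp }
  have h₁ := hasFiniteSupport_of_isZero hm (K := L.X) hL
  have h₂ := hasFiniteSupport_of_isZero hm (K := fun n => K.X (n + 1)) (a := a - 1) (b := b - 1)
    (fun n hn => hK (n + 1) (by omega))
  simp only [eulerChar, e, smul_add]
  rw [finsum_add_distrib h₁ h₂, sub_eq_add_neg]
  congr 1
  -- Reindexing by `n ↦ n + 1` turns the shift of `K` in the cone into the sign change.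
  rw [← finsum_neg_distrib,
    ← finsum_comp_equiv (Equiv.addRight (1 : ℤ)) (f := fun n => -(n.negOnePow • m (K.X n)))]
  refine finsum_congr (fun n => ?_)
  simp [Int.negOnePow_succ]

end EulerCharacteristic

/-! ### Vanishing of the Euler characteristic on retracts of acyclic complexes. -/

section Retracts

variable {E : Type u} [Category.{v} E] [Preadditive E] [HasZeroObject E]
  [HasBinaryBiproducts E] [ExactCategory E]

/-- The cycles of `X` are built upwards as retracts `W` of the cycles `Z n`. Each step yields a
short exact sequence `W ⟶ X.X n ⟶ W'` with `W'` a retract of `Z (n + 1)`, so the alternating sum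
telescopes; both ends vanish. -/
lemma sum_eq_zero_of_strict_retract (hE : IsWeaklyIdempotentComplete E)
    {X : CochainComplex E ℤ} {Z B : ℤ → E} {i : ∀ n, Z n ⟶ B n} {p : ∀ n, B n ⟶ Z (n + 1)}
    (h : ∀ n, IsShortExact (i n) (p n)) {b : ∀ n, X.X n ⟶ B n} {r : ∀ n, B n ⟶ X.X n}
    (hb : ∀ n, b n ≫ r n = 𝟙 (X.X n))
    (h₁ : ∀ n, X.d n (n + 1) ≫ b (n + 1) = b n ≫ p n ≫ i (n + 1))
    (h₂ : ∀ n, p n ≫ i (n + 1) ≫ r (n + 1) = r n ≫ X.d n (n + 1)) {a : ℤ}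
    (ha : IsZero (Z a)) {k : ℕ} (hk : IsZero (Z (a + k))) :
    ∑ j ∈ Finset.range k, (a + j).negOnePow • ExactK0.mk (X.X (a + j)) = 0 := by
  have key : ∀ (k : ℕ) (n : ℤ), n = a + k → ∃ (W : E) (j : W ⟶ X.X n) (c : W ⟶ Z n)
      (s : Z n ⟶ W), c ≫ s = 𝟙 W ∧ j ≫ b n = c ≫ i n ∧ i n ≫ r n = s ≫ j ∧
      ∑ j ∈ Finset.range k, (a + j).negOnePow • ExactK0.mk (X.X (a + j)) =
        - n.negOnePow • ExactK0.mk W := by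
    intro k
    induction k with
    | zero =>
      rintro n rfl
      refine ⟨0, 0, 0, 0, (isZero_zero E).eq_of_src _ _, by simp, ?_, ?_⟩
      · exact IsZero.eq_of_src (by simpa using ha) _ _
      · simp [ExactK0.mk_eq_zero (isZero_zero E)]
    | succ k hk =>
      intro n hn
      obtain ⟨n, rfl⟩ : ∃ n', n = n' + 1 := ⟨n - 1, by simp⟩
      have hn : n = a + k := by push_cast at hn; omega
      obtain ⟨W, j, c, s, hcs, w₁, w₂, hW⟩ := hk n hn
      obtain ⟨W', q, c', s', hq, hcs', w₁', w₂'⟩ :=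
        exists_isShortExact_of_retract hE (h n) j hcs (hb n) w₁ w₂
      have := hq.epi
      have := (h n).epi
      -- Preceded by `q`, this map `W' ⟶ X.X (n + 1)` is the differential of `X`, so `W'` plays the
      -- role of its image.
      refine ⟨W', c' ≫ i (n + 1) ≫ r (n + 1), c', s', hcs', ?_, ?_, ?_⟩
      · rw [← cancel_epi q]
        simp only [Category.assoc, reassoc_of% w₁']
        rw [reassoc_of% (h₂ n), reassoc_of% (hb n), h₁]
      · rw [← cancel_epi (p n), reassoc_of% w₂', reassoc_of% w₁', h₂, reassoc_of% (hb n)]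
      · rw [Finset.sum_range_succ, hW, ← hn, ExactK0.mk_eq_add hq, Int.negOnePow_succ, smul_add]
        simp
  obtain ⟨W, j, c, s, hcs, -, -, hW⟩ := key k _ rfl
  have hW₀ : IsZero W := by
    rw [IsZero.iff_id_eq_zero, ← hcs, hk.eq_of_tgt c 0, zero_comp]
  rw [hW, ExactK0.mk_eq_zero hW₀, smul_zero]

/-- The Euler characteristic of a bounded complex vanishes if it is a retract up to homotopy of
a bounded acyclic complex. -/
lemma eulerChar_eq_zero_of_retract (hE : IsWeaklyIdempotentComplete E)
    {X N : CochainComplex E ℤ} (hX : bounded E ((HomotopyCategory.quotient _ _).obj X))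
    (hN : bounded E ((HomotopyCategory.quotient _ _).obj N)) (hN' : IsAcyclic N)
    (f : X ⟶ N) (g : N ⟶ X) (h : Homotopy (f ≫ g) (𝟙 X)) :
    eulerChar ExactK0.mk X = 0 := by
  obtain ⟨a₁, b₁, hX⟩ := hX
  obtain ⟨a₂, b₂, hN⟩ := hN
  obtain ⟨Z, i, p, hp⟩ := hN'
  -- The window `[a, a + k)` starts strictly below both supports and ends above them, so the cycles
  -- `Z n ⊞ X.X n` of the enlarged complex vanish at `a` and at `a + k`.
  obtain ⟨a, ha₁, ha₂⟩ : ∃ a, a < a₁ ∧ a < a₂ := ⟨min a₁ a₂ - 1, by omega, by omega⟩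
  obtain ⟨k, hk₁, hk₂⟩ : ∃ k : ℕ, b₁ < a + k ∧ b₂ < a + k :=
    ⟨(max b₁ b₂ - a).toNat + 1, by omega, by omega⟩
  have hZ : ∀ n, IsZero (N.X n) → IsZero (Z n) := fun n hn => by
    have := (hp n).2.mono
    rw [IsZero.iff_id_eq_zero, ← cancel_mono (i n)]
    exact hn.eq_of_tgt _ _
  rw [eulerChar_eq_sum_range (K := X) (fun _ => ExactK0.mk_eq_zero) a k (fun n hn => hX n (by omega))]
  -- The acyclic complex is enlarged by the contractible one with terms `X.X n ⊞ X.X (n + 1)`, whose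
  -- differential is `biprod.snd` followed by `biprod.inl`.
  have hs : ∀ n, IsShortExact _ _ := fun n =>
    (hp n).2.biprod_map (isShortExact_inl_snd (X.X n) (X.X (n + 1)))
  have hc : ∀ n, f.f n ≫ g.f n - prevD n h.hom - X.d n (n + 1) ≫ h.hom (n + 1) n = 𝟙 _ :=
    fun n => by
      have := h.comm n
      rw [dNext_eq h.hom (show (ComplexShape.up ℤ).Rel n (n + 1) from rfl)] at this
      simp only [HomologicalComplex.comp_f, HomologicalComplex.id_f] at this
      rw [this]
      abel
  -- The two extra components of `b ≫ r` contribute exactly the homotopy terms, correcting `f ≫ g`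
  -- to the identity.
  refine sum_eq_zero_of_strict_retract hE hs
    (b := fun n => biprod.lift (f.f n) (biprod.lift (𝟙 _) (X.d n (n + 1))))
    (r := fun n => biprod.desc (g.f n) (biprod.desc (- prevD n h.hom) (- h.hom (n + 1) n)))
    (fun n => ?_) (fun n => ?_) (fun n => ?_) ?_ ?_
  · refine Eq.trans ?_ (hc n)
    simp only [biprod.lift_desc, Preadditive.comp_neg, Category.id_comp]
    abel
  · ext
    · simpa [(hp n).1] using (f.comm n (n + 1)).symm
    · simp
    · simp
  · ext
    · simp [← reassoc_of% (hp n).1]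
    · simp
    · simp [prevD_eq h.hom (show (ComplexShape.up ℤ).Rel n (n + 1) from rfl)]
  · have := hZ a (hN a (by omega))
    rw [IsZero.iff_id_eq_zero]
    ext
    · exact this.eq_of_src _ _
    · exact this.eq_of_src _ _
    · exact (hX a (by omega)).eq_of_src _ _
    · exact (hX a (by omega)).eq_of_src _ _
  · have := hZ (a + k) (hN _ (by omega))
    rw [IsZero.iff_id_eq_zero]
    ext
    · exact this.eq_of_src _ _
    · exact this.eq_of_src _ _
    · exact (hX (a + k) (by omega)).eq_of_src _ _
    · exact (hX (a + k) (by omega)).eq_of_src _ _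

end Retracts

end ExactCat

namespace ExactCat

/-! ### The Euler characteristic on the bounded derived category. -/

section Verdier

variable {C : Type*} [Category* C] [HasZeroObject C] [HasShift C ℤ] [Preadditive C]
  [∀ n : ℤ, (shiftFunctor C n).Additive] [Pretriangulated C] [IsTriangulated C]

/-- An object which becomes zero in a Verdier quotient is a retract of an object of the
triangulated subcategory. -/
lemma exists_retract_of_isZero_Q_obj (P : ObjectProperty C) [P.IsTriangulated] {X : C}
    (hX : IsZero (P.trW.Q.obj X)) :
    ∃ (N : C) (_ : P N) (f : X ⟶ N) (g : N ⟶ X), f ≫ g = 𝟙 X := by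
  -- The identity and zero of `X` agree after precomposition with some `s` in `P.trW`, so `s = 0`
  -- and the identity factors through the cone `N` of `s`.
  obtain ⟨Y, s, ⟨N, q, r, hT, hN⟩, hs'⟩ :=
    (MorphismProperty.map_eq_iff_precomp P.trW.Q P.trW (𝟙 X) 0).1 (hX.eq_of_src _ _)
  obtain ⟨g, hg⟩ := Triangle.yoneda_exact₂ _ hT (𝟙 X) (hs'.trans comp_zero)
  exact ⟨N, hN, q, g, hg.symm⟩

end Verdier

section DerivedCategory

variable {E : Type u} [Category.{v} E] [Preadditive E] [HasZeroObject E] [HasBinaryBiproducts E]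

/-- The object of `K^b(E)` given by a bounded complex. -/
abbrev boundedMk (K : CochainComplex E ℤ)
    (hK : bounded E ((HomotopyCategory.quotient _ _).obj K)) : BoundedHomotopyCategory E :=
  ⟨(HomotopyCategory.quotient _ _).obj K, hK⟩

/-- This replaces the third vertex by an actual mapping cone, whose terms are known. -/
lemma exists_iso_mappingCone {T : Triangle (BoundedHomotopyCategory E)} (hT : T ∈ distTriang _) :
    ∃ (φ : T.obj₁.obj.as ⟶ T.obj₂.obj.as) (hφ : _),
      Nonempty (T.obj₃ ≅ boundedMk (CochainComplex.mappingCone φ) hφ) := by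
  obtain ⟨a₁, b₁, h₁⟩ := T.obj₁.property
  obtain ⟨a₂, b₂, h₂⟩ := T.obj₂.property
  obtain ⟨φ : T.obj₁.obj.as ⟶ T.obj₂.obj.as, hφ⟩ :=
    (HomotopyCategory.quotient _ _).map_surjective T.mor₁.hom
  refine ⟨φ, ⟨min (a₁ - 1) a₂, max b₁ b₂, fun n hn =>
    (CochainComplex.mappingCone.isZero_X_iff φ n).2 ⟨h₁ _ (by omega), h₂ _ (by omega)⟩⟩,
    ⟨(bounded E).fullyFaithfulι.preimageIso (Triangle.π₃.mapIso
      (isoTriangleOfIso₁₂ _ _ ((bounded E).ι.map_distinguished _ hT)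
        (HomotopyCategory.mappingCone_triangleh_distinguished φ)
        (Iso.refl _) (Iso.refl _) ?_))⟩⟩
  exact (Category.comp_id _).trans (hφ.symm.trans (Category.id_comp _).symm)

variable [ExactCategory E]

lemma eulerChar_eq_zero_of_isZero_Q_obj (hE : IsWeaklyIdempotentComplete E)
    {K : BoundedHomotopyCategory E} (hK : IsZero ((acyclicComplexes E).trW.Q.obj K)) :
    eulerChar ExactK0.mk K.obj.as = 0 := by
  obtain ⟨N, ⟨M, hM, ⟨e⟩⟩, f, g, hfg⟩ := exists_retract_of_isZero_Q_obj _ hK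
  obtain ⟨f' : K.obj.as ⟶ M.obj.as, hf'⟩ :=
    (HomotopyCategory.quotient _ _).map_surjective (f ≫ e.hom).hom
  obtain ⟨g' : M.obj.as ⟶ K.obj.as, hg'⟩ :=
    (HomotopyCategory.quotient _ _).map_surjective (e.inv ≫ g).hom
  refine eulerChar_eq_zero_of_retract hE K.property M.property hM f' g'
    (HomotopyCategory.homotopyOfEq _ _ ?_)
  have h : (f ≫ e.hom) ≫ e.inv ≫ g = 𝟙 K := by simp [hfg]
  exact ((HomotopyCategory.quotient _ _).map_comp f' g').trans
    (((congrArg₂ (· ≫ ·) hf' hg').trans ((bounded E).ι.congr_map h)).trans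
      ((HomotopyCategory.quotient _ _).map_id _).symm)

lemma eulerChar_mappingCone_of_bounded {K L : BoundedHomotopyCategory E}
    (φ : K.obj.as ⟶ L.obj.as) :
    eulerChar ExactK0.mk (CochainComplex.mappingCone φ) =
      eulerChar ExactK0.mk L.obj.as - eulerChar ExactK0.mk K.obj.as :=
  eulerChar_mappingCone (fun _ => ExactK0.mk_eq_zero) (fun _ _ => ExactK0.mk_eq_of_iso)
    ExactK0.mk_biprod K.property L.property φ

/-- The cone of `f` becomes zero in `D^b(E)`, so its Euler characteristic, the difference of the two
sides, vanishes. -/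
lemma eulerChar_eq_of_isIso_Q_map (hE : IsWeaklyIdempotentComplete E)
    {K L : BoundedHomotopyCategory E} (f : K ⟶ L)
    [IsIso ((acyclicComplexes E).trW.Q.map f)] :
    eulerChar ExactK0.mk K.obj.as = eulerChar ExactK0.mk L.obj.as := by
  obtain ⟨Z, g, h, hT⟩ := distinguished_cocone_triangle f
  obtain ⟨φ, hφ, ⟨e⟩⟩ := exists_iso_mappingCone hT
  have hZ : IsZero ((acyclicComplexes E).trW.Q.obj Z) :=
    Triangle.isZero₃_of_isIso₁ _ ((acyclicComplexes E).trW.Q.map_distinguished _ hT) ‹_›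
  have := eulerChar_eq_zero_of_isZero_Q_obj hE
    (hZ.of_iso ((acyclicComplexes E).trW.Q.mapIso e.symm))
  have h' := eulerChar_mappingCone_of_bounded (K := K) (L := L) φ
  exact (sub_eq_zero.1 (h'.symm.trans this)).symm

/-- The Euler characteristic only depends on the isomorphism class in `D^b(E)`. -/
lemma eulerChar_eq_of_iso_Q_obj (hE : IsWeaklyIdempotentComplete E)
    {K L : BoundedHomotopyCategory E}
    (e : (acyclicComplexes E).trW.Q.obj K ≅ (acyclicComplexes E).trW.Q.obj L) :
    eulerChar ExactK0.mk K.obj.as = eulerChar ExactK0.mk L.obj.as := by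
  -- In a left fraction representing an isomorphism, both legs become invertible in `D^b(E)`.
  obtain ⟨φ, hφ⟩ := Localization.exists_leftFraction (acyclicComplexes E).trW.Q
    (acyclicComplexes E).trW e.hom
  have hs := Localization.inverts (acyclicComplexes E).trW.Q _ _ φ.hs
  have hf : IsIso ((acyclicComplexes E).trW.Q.map φ.f) := by
    have : (acyclicComplexes E).trW.Q.map φ.f =
        e.hom ≫ (acyclicComplexes E).trW.Q.map φ.s := by
      rw [hφ, MorphismProperty.LeftFraction.map_comp_map_s]
    rw [this]
    infer_instance
  rw [eulerChar_eq_of_isIso_Q_map hE φ.f, eulerChar_eq_of_isIso_Q_map hE φ.s]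

lemma eulerChar_of_distinguished (hE : IsWeaklyIdempotentComplete E)
    {T : Triangle (BoundedHomotopyCategory E)} (hT : T ∈ distTriang _) :
    eulerChar ExactK0.mk T.obj₂.obj.as =
      eulerChar ExactK0.mk T.obj₁.obj.as + eulerChar ExactK0.mk T.obj₃.obj.as := by
  obtain ⟨φ, hφ, ⟨e⟩⟩ := exists_iso_mappingCone hT
  have h := eulerChar_eq_of_iso_Q_obj hE ((acyclicComplexes E).trW.Q.mapIso e)
  have h' := eulerChar_mappingCone_of_bounded φ
  rw [h]
  exact (add_eq_of_eq_sub' h').symm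

lemma exists_Q_obj_iso (X : BoundedDerivedCategory E) :
    ∃ K : BoundedHomotopyCategory E, Nonempty ((acyclicComplexes E).trW.Q.obj K ≅ X) := by
  have := Localization.essSurj (acyclicComplexes E).trW.Q (acyclicComplexes E).trW
  exact ⟨_, ⟨(acyclicComplexes E).trW.Q.objObjPreimageIso X⟩⟩

/-- The homomorphism `K₀(D^b(E)) → K₀(E)` given by the Euler characteristic. -/
lemma exists_eulerCharHom (hE : IsWeaklyIdempotentComplete E) :
    ∃ χ : TriangulatedK0 (BoundedDerivedCategory E) →+ ExactK0 E,
      ∀ K : BoundedHomotopyCategory E,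
        χ (TriangulatedK0.mk ((acyclicComplexes E).trW.Q.obj K)) =
          eulerChar ExactK0.mk K.obj.as := by
  choose F e using exists_Q_obj_iso (E := E)
  let χ₀ : IsoClass (BoundedDerivedCategory E) → ExactK0 E :=
    Quotient.lift (fun X => eulerChar ExactK0.mk (F X).obj.as) (fun X Y ⟨i⟩ =>
      eulerChar_eq_of_iso_Q_obj hE ((e X).some ≪≫ i ≪≫ (e Y).some.symm))
  -- The value at `X` may be computed from any complex representing `X`, not just the chosen `F X`.
  have h₀ : ∀ X K, ((acyclicComplexes E).trW.Q.obj K ≅ X) →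
      FreeAbelianGroup.lift χ₀ (isoClassOf X) = eulerChar ExactK0.mk K.obj.as := fun X K i =>
    (FreeAbelianGroup.lift_apply_of _ _).trans
      (eulerChar_eq_of_iso_Q_obj hE ((e X).some ≪≫ i.symm))
  refine ⟨QuotientAddGroup.lift _ (FreeAbelianGroup.lift χ₀) ?_, fun K =>
    (QuotientAddGroup.lift_mk _ _ _).trans (h₀ _ K (Iso.refl _))⟩
  rw [AddSubgroup.closure_le]
  -- Exact triangles of the Verdier quotient are, up to isomorphism, images of exact triangles `T`
  -- of `K^b(E)`.
  rintro _ ⟨Δ, ⟨T, i, hT⟩, rfl⟩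
  have h := eulerChar_of_distinguished hE hT
  rw [SetLike.mem_coe, AddMonoidHom.mem_ker, map_add, map_sub,
    h₀ Δ.obj₁ T.obj₁ (Triangle.π₁.mapIso i.symm), h₀ Δ.obj₂ T.obj₂ (Triangle.π₂.mapIso i.symm),
    h₀ Δ.obj₃ T.obj₃ (Triangle.π₃.mapIso i.symm), h]
  abel

end DerivedCategory

end ExactCat

namespace ExactCat

/-! ### Brutal truncation and the class of a complex in `K₀(D^b(E))`. -/

section Truncation

variable {E : Type u} [Category.{v} E] [Preadditive E] [HasZeroObject E]

open Classical in
/-- The subcomplex of a complex given by the terms of degree greater than `a`. -/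
noncomputable def truncGT (K : CochainComplex E ℤ) (a : ℤ) : CochainComplex E ℤ where
  X n := if a < n then K.X n else 0
  d i j := if h : a < i ∧ a < j then
    eqToHom (if_pos h.1) ≫ K.d i j ≫ eqToHom (if_pos h.2).symm else 0
  shape i j hij := by
    by_cases h : a < i ∧ a < j
    · rw [dif_pos h, K.shape _ _ hij, zero_comp, comp_zero]
    · exact dif_neg h
  d_comp_d' i j k _ _ := by
    by_cases h : a < i ∧ a < j
    · by_cases h' : a < j ∧ a < k
      · simp [dif_pos h, dif_pos h']
      · rw [dif_neg h', comp_zero]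
    · rw [dif_neg h, zero_comp]

lemma isZero_truncGT_X (K : CochainComplex E ℤ) (a n : ℤ) (hn : n ≤ a) :
    IsZero ((truncGT K a).X n) := by
  simpa [truncGT, hn.not_gt] using isZero_zero E

/-- The terms of degree greater than `a` are unchanged by the truncation. -/
noncomputable def truncGTXIso (K : CochainComplex E ℤ) (a n : ℤ) (hn : a < n) :
    (truncGT K a).X n ≅ K.X n :=
  eqToIso (if_pos hn)

lemma truncGT_d (K : CochainComplex E ℤ) (a i j : ℤ) (hi : a < i) (hj : a < j) :
    (truncGT K a).d i j =
      (truncGTXIso K a i hi).hom ≫ K.d i j ≫ (truncGTXIso K a j hj).inv :=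
  dif_pos ⟨hi, hj⟩

open Classical in
/-- The inclusion of the subcomplex of the terms of degree greater than `a`. -/
noncomputable def truncGTι (K : CochainComplex E ℤ) (a : ℤ) : truncGT K a ⟶ K where
  f n := if h : a < n then (truncGTXIso K a n h).hom else 0
  comm' i j hij := by
    obtain rfl : i + 1 = j := hij
    by_cases h : a < i
    · have h' : a < i + 1 := by omega
      simp [h, h', truncGT_d]
    · exact (isZero_truncGT_X K a i (by omega)).eq_of_src _ _

lemma isIso_truncGTι_f (K : CochainComplex E ℤ) (a n : ℤ) (hn : a < n) :
    IsIso ((truncGTι K a).f n) := by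
  simp only [truncGTι, hn, dite_true]
  infer_instance

/-- The projection of a complex to its lowest term. -/
noncomputable def toLowestTerm (K : CochainComplex E ℤ) (a : ℤ) (ha : IsZero (K.X (a - 1))) :
    K ⟶ (HomologicalComplex.single E (ComplexShape.up ℤ) a).obj (K.X a) :=
  HomologicalComplex.mkHomToSingle (𝟙 (K.X a)) (fun i hi => by
    obtain rfl : i = a - 1 := eq_sub_of_add_eq hi
    exact ha.eq_of_src _ _)

lemma isIso_toLowestTerm_f (K : CochainComplex E ℤ) (a : ℤ) (ha : IsZero (K.X (a - 1))) :
    IsIso ((toLowestTerm K a ha).f a) := by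
  rw [toLowestTerm, HomologicalComplex.mkHomToSingle_f]
  infer_instance

/-- The exact sequence of complexes splitting off the lowest term. -/
noncomputable def truncGTShortComplex (K : CochainComplex E ℤ) (a : ℤ)
    (ha : IsZero (K.X (a - 1))) : ShortComplex (CochainComplex E ℤ) :=
  ShortComplex.mk (truncGTι K a) (toLowestTerm K a ha) (by
    rw [toLowestTerm]
    ext
    exact (isZero_truncGT_X K a a le_rfl).eq_of_src _ _)

lemma nonempty_splitting_truncGTShortComplex (K : CochainComplex E ℤ) (a : ℤ)
    (hK : ∀ n, n < a → IsZero (K.X n)) (n : ℤ) :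
    Nonempty (((truncGTShortComplex K a (hK _ (by omega))).map
      (HomologicalComplex.eval E _ n)).Splitting) := by
  by_cases h : a < n
  · have := isIso_truncGTι_f K a n h
    exact ⟨ShortComplex.Splitting.ofIsIsoOfIsZero _ this
      (HomologicalComplex.isZero_single_obj_X (ComplexShape.up ℤ) _ _ _ (by omega))⟩
  · refine ⟨ShortComplex.Splitting.ofIsZeroOfIsIso _ (isZero_truncGT_X K a n (by omega)) ?_⟩
    obtain rfl | h' := eq_or_ne n a
    · exact isIso_toLowestTerm_f K n (hK _ (by omega))
    · have h₁ := hK n (by omega)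
      have h₂ := HomologicalComplex.isZero_single_obj_X (ComplexShape.up ℤ) a (K.X a) n h'
      exact ⟨0, h₁.eq_of_src _ _, h₂.eq_of_src _ _⟩

end Truncation

section DerivedCategory

variable {E : Type u} [Category.{v} E] [Preadditive E] [HasZeroObject E] [HasBinaryBiproducts E]

/-- Degreewise split sequences give triangles in the homotopy category; fullness of `K^b(E)` in it
transports the third vertex. -/
lemma exists_distinguished_of_splitting (S : ShortComplex (CochainComplex E ℤ))
    (σ : ∀ n, (S.map (HomologicalComplex.eval E _ n)).Splitting)
    (h₁ : bounded E ((HomotopyCategory.quotient _ _).obj S.X₁))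
    (h₂ : bounded E ((HomotopyCategory.quotient _ _).obj S.X₂))
    (h₃ : bounded E ((HomotopyCategory.quotient _ _).obj S.X₃)) :
    ∃ T ∈ distTriang (BoundedHomotopyCategory E), T.obj₁ = boundedMk S.X₁ h₁ ∧
      T.obj₂ = boundedMk S.X₂ h₂ ∧ Nonempty (T.obj₃ ≅ boundedMk S.X₃ h₃) := by
  let f : boundedMk S.X₁ h₁ ⟶ boundedMk S.X₂ h₂ :=
    ObjectProperty.homMk ((HomotopyCategory.quotient _ _).map S.f)
  obtain ⟨Z, g, h, hT⟩ := distinguished_cocone_triangle f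
  have hS : CochainComplex.trianglehOfDegreewiseSplit S σ ∈ distTriang _ :=
    (HomotopyCategory.distinguished_iff_iso_trianglehOfDegreewiseSplit _).2 ⟨S, σ, ⟨Iso.refl _⟩⟩
  refine ⟨_, hT, rfl, rfl, ⟨(bounded E).fullyFaithfulι.preimageIso (Triangle.π₃.mapIso
    (isoTriangleOfIso₁₂ _ _ ((bounded E).ι.map_distinguished _ hT) hS
        (Iso.refl _) (Iso.refl _) ?_))⟩⟩
  exact (Category.comp_id _).trans (Category.id_comp _).symm

variable [ExactCategory E]

/-- The class in `K₀(D^b(E))` of a bounded complex. -/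
noncomputable def complexClass (K : CochainComplex E ℤ)
    (hK : bounded E ((HomotopyCategory.quotient _ _).obj K)) :
    TriangulatedK0 (BoundedDerivedCategory E) :=
  TriangulatedK0.mk ((acyclicComplexes E).trW.Q.obj (boundedMk K hK))

/-- The class in `K₀(D^b(E))` of an object of `E`. -/
noncomputable def objectClass (X : E) : TriangulatedK0 (BoundedDerivedCategory E) :=
  TriangulatedK0.mk ((toBoundedDerivedCategory E).obj X)

lemma objectClass_eq_of_iso {X Y : E} (e : X ≅ Y) : objectClass X = objectClass Y :=
  TriangulatedK0.mk_eq_of_iso ((toBoundedDerivedCategory E).mapIso e)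

lemma complexClass_of_splitting (S : ShortComplex (CochainComplex E ℤ))
    (σ : ∀ n, (S.map (HomologicalComplex.eval E _ n)).Splitting)
    (h₁ : bounded E ((HomotopyCategory.quotient _ _).obj S.X₁))
    (h₂ : bounded E ((HomotopyCategory.quotient _ _).obj S.X₂))
    (h₃ : bounded E ((HomotopyCategory.quotient _ _).obj S.X₃)) :
    complexClass S.X₂ h₂ = complexClass S.X₁ h₁ + complexClass S.X₃ h₃ := by
  obtain ⟨T, hT, e₁, e₂, ⟨e₃⟩⟩ := exists_distinguished_of_splitting S σ h₁ h₂ h₃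
  have h := TriangulatedK0.mk_eq_add ((acyclicComplexes E).trW.Q.map_distinguished _ hT)
  refine Eq.trans ?_ (h.trans (congrArg₂ (· + ·) ?_ ?_))
  · exact TriangulatedK0.mk_eq_of_iso ((acyclicComplexes E).trW.Q.mapIso (eqToIso e₂.symm))
  · exact TriangulatedK0.mk_eq_of_iso ((acyclicComplexes E).trW.Q.mapIso (eqToIso e₁))
  · exact TriangulatedK0.mk_eq_of_iso ((acyclicComplexes E).trW.Q.mapIso e₃)

/-- The complex with `X` in degree `a` is the shift by `-a` of the one in degree zero, and each
shift by one changes the sign. -/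
lemma complexClass_single (X : E) (a : ℤ)
    (h : bounded E ((HomotopyCategory.quotient _ _).obj
      ((HomologicalComplex.single E (ComplexShape.up ℤ) a).obj X))) :
    complexClass _ h = a.negOnePow • objectClass X := by
  let e : ((toBoundedHomotopyCategory E).obj X)⟦-a⟧ ≅ boundedMk _ h :=
    (bounded E).fullyFaithfulι.preimageIso (((bounded E).ι.commShiftIso (-a)).app _ ≪≫
      ((HomotopyCategory.singleFunctors E).shiftIso (-a) a 0 (by omega)).app X)
  have := TriangulatedK0.mk_shift ((toBoundedDerivedCategory E).obj X) (-a)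
  rw [Int.negOnePow_neg] at this
  exact (TriangulatedK0.mk_eq_of_iso ((acyclicComplexes E).trW.Q.mapIso e.symm ≪≫
    ((acyclicComplexes E).trW.Q.commShiftIso (-a)).app _)).trans this

lemma complexClass_eq_zero_of_isAcyclic {K : CochainComplex E ℤ} (hK : IsAcyclic K)
    (h : bounded E ((HomotopyCategory.quotient _ _).obj K)) : complexClass K h = 0 := by
  have hP : acyclicComplexes E (boundedMk K h) := ObjectProperty.le_isoClosure _ _ hK
  -- In the contractible triangle the second morphism is `K ⟶ 0` and the first vertex is acyclic, so
  -- `K ⟶ 0` is inverted.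
  have hW := ObjectProperty.trW.mk' _ (contractible_distinguished (boundedMk K h)) hP
  have := Localization.inverts (acyclicComplexes E).trW.Q _ _ hW
  have h₀ := Functor.map_isZero (acyclicComplexes E).trW.Q
    (isZero_zero (BoundedHomotopyCategory E))
  exact TriangulatedK0.mk_eq_zero (h₀.of_iso (@asIso _ _ _ _ _ this))

lemma objectClass_eq_zero {X : E} (hX : IsZero X) : objectClass X = 0 :=
  complexClass_eq_zero_of_isAcyclic (isAcyclic_zero fun n => by
    obtain rfl | hn := eq_or_ne n 0
    · exact hX.of_iso (HomologicalComplex.singleObjXSelf _ 0 X)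
    · exact HomologicalComplex.isZero_single_obj_X _ _ _ _ hn)
    ((toBoundedHomotopyCategory E).obj X).property

/-- The class of a bounded complex in `K₀(D^b(E))` is the alternating sum of the classes of its
terms. -/
lemma complexClass_eq_eulerChar (K : CochainComplex E ℤ)
    (h : bounded E ((HomotopyCategory.quotient _ _).obj K)) :
    complexClass K h = eulerChar objectClass K := by
  -- Induction on the length `k` of a window `[a, a + k)` containing the support; splitting off the
  -- term in degree `a` moves the window to `[a + 1, a + 1 + k)`.
  have key : ∀ (k : ℕ) (a : ℤ) (K : CochainComplex E ℤ)
      (h : bounded E ((HomotopyCategory.quotient _ _).obj K)),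
      (∀ n, (n < a ∨ a + k ≤ n) → IsZero (K.X n)) →
      complexClass K h = eulerChar objectClass K := by
    intro k
    induction k with
    | zero =>
      intro a K h hK
      rw [complexClass_eq_zero_of_isAcyclic (isAcyclic_zero fun n => hK n (by omega)),
        eulerChar_eq_sum_range (fun _ => objectClass_eq_zero) a 0 hK, Finset.sum_range_zero]
    | succ k hk =>
      intro a K h hK
      have hL : ∀ n, (n < a + 1 ∨ a + 1 + k ≤ n) → IsZero ((truncGT K a).X n) := fun n hn => by
        by_cases hn' : n ≤ a
        · exact isZero_truncGT_X K a n hn'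
        · exact (hK n (by push_cast; omega)).of_iso (truncGTXIso K a n (by omega))
      have hL' : bounded E ((HomotopyCategory.quotient _ _).obj (truncGT K a)) :=
        ⟨a + 1, a + 1 + k, fun n hn => hL n (by omega)⟩
      have hs : bounded E ((HomotopyCategory.quotient _ _).obj
          ((HomologicalComplex.single E (ComplexShape.up ℤ) a).obj (K.X a))) :=
        ⟨a, a, fun n hn => HomologicalComplex.isZero_single_obj_X _ _ _ _ (by omega)⟩
      have h₁ := complexClass_of_splitting
        (truncGTShortComplex K a (hK _ (by omega)))
        (fun n => (nonempty_splitting_truncGTShortComplex K a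
          (fun n hn => hK n (by omega)) n).some) hL' h hs
      have h₂ := hk _ _ hL' hL
      refine h₁.trans ?_
      refine (congrArg₂ (· + ·) h₂ (complexClass_single _ _ hs)).trans ?_
      have hf : (fun n : ℤ => n.negOnePow • objectClass (K.X n)) = fun n =>
          n.negOnePow • objectClass ((truncGT K a).X n) +
            if n = a then a.negOnePow • objectClass (K.X a) else 0 := by
        funext n
        obtain hn | rfl | hn := lt_trichotomy n a
        · rw [objectClass_eq_zero (hK n (by omega)),
            objectClass_eq_zero (isZero_truncGT_X K a n (by omega)), if_neg (by omega), add_zero]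
        · rw [objectClass_eq_zero (isZero_truncGT_X K n n le_rfl), if_pos rfl, smul_zero, zero_add]
        · rw [objectClass_eq_of_iso (truncGTXIso K a n hn), if_neg (by omega), add_zero]
      dsimp only [eulerChar]
      rw [hf, finsum_add_distrib]
      · congr 1
        rw [finsum_eq_single _ a (fun n hn => if_neg hn), if_pos rfl]
      · obtain ⟨b, c, hbc⟩ := hL'
        exact hasFiniteSupport_of_isZero (fun _ => objectClass_eq_zero) hbc
      · exact (Set.finite_singleton a).subset (fun n hn => by
          by_contra hn'
          exact hn (if_neg hn'))
  obtain ⟨a, b, hK⟩ := id h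
  exact key (b + 1 - a).toNat a K h (fun n hn => hK n (by omega))

end DerivedCategory

end ExactCat

namespace ExactCat

/-! ### Short exact sequences as acyclic complexes. -/

section ThreeTermComplex

variable {E : Type u} [Category.{v} E] [Preadditive E] [HasZeroObject E]

/-- The terms of the complex `A ⟶ B ⟶ C` with `A` in degree zero. -/
noncomputable def threeTermX (A B C : E) : ℤ → E
  | .ofNat 0 => A
  | .ofNat 1 => B
  | .ofNat 2 => C
  | .ofNat (_ + 3) => 0
  | .negSucc _ => 0

/-- The cycles of the complex `A ⟶ B ⟶ C` attached to a short exact sequence. -/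
noncomputable def threeTermZ (A C : E) : ℤ → E
  | .ofNat 0 => 0
  | .ofNat 1 => A
  | .ofNat 2 => C
  | .ofNat (_ + 3) => 0
  | .negSucc _ => 0

/-- The inclusions of the cycles in the complex attached to a short exact sequence. -/
noncomputable def threeTermι {A B : E} (C : E) (f : A ⟶ B) :
    ∀ n : ℤ, threeTermZ A C n ⟶ threeTermX A B C n
  | .ofNat 0 => (0 : (0 : E) ⟶ A)
  | .ofNat 1 => f
  | .ofNat 2 => 𝟙 C
  | .ofNat (_ + 3) => 𝟙 0
  | .negSucc _ => 𝟙 0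

/-- The projections to the cycles in the complex attached to a short exact sequence. -/
noncomputable def threeTermπ (A : E) {B C : E} (g : B ⟶ C) :
    ∀ n : ℤ, threeTermX A B C n ⟶ threeTermZ A C (n + 1)
  | .ofNat 0 => 𝟙 A
  | .ofNat 1 => g
  | .ofNat 2 => (0 : C ⟶ 0)
  | .ofNat (_ + 3) => (0 : (0 : E) ⟶ 0)
  | .negSucc _ => 0

variable [HasBinaryBiproducts E] [ExactCategory E]

lemma isShortExact_zero_id (X : E) {O : E} (hO : IsZero O) : IsShortExact (0 : O ⟶ X) (𝟙 X) := by
  have : Mono (0 : O ⟶ X) := ⟨fun a b _ => hO.eq_of_tgt a b⟩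
  exact IsShortExact.of_admEpi (ExactCategory.id_epi X) (by simp)
    (fun t ht => ⟨0, by simpa using ht.symm⟩)

lemma isShortExact_threeTerm {A B C : E} {f : A ⟶ B} {g : B ⟶ C} (h : IsShortExact f g) (n : ℤ) :
    IsShortExact (threeTermι C f n) (threeTermπ A g n) := by
  match n with
  | .ofNat 0 => exact isShortExact_zero_id A (isZero_zero E)
  | .ofNat 1 => exact h
  | .ofNat 2 => exact IsShortExact.zero C (isZero_zero E)
  | .ofNat (_ + 3) => exact IsShortExact.zero _ (isZero_zero E)
  | .negSucc n =>
    refine IsShortExact.zero _ ?_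
    -- The index `-1` is separate: its successor is `0`, which falls under another clause of
    -- `threeTermZ`.
    obtain _ | n := n <;> exact isZero_zero E

/-- A short exact sequence is an acyclic complex. -/
lemma exists_isAcyclic_of_isShortExact {A B C : E} {f : A ⟶ B} {g : B ⟶ C}
    (h : IsShortExact f g) : ∃ K : CochainComplex E ℤ, IsAcyclic K ∧ K.X = threeTermX A B C := by
  let d : ∀ n, threeTermX A B C n ⟶ threeTermX A B C (n + 1) := fun n =>
    threeTermπ A g n ≫ threeTermι C f (n + 1)
  have hd : ∀ n, d n ≫ d (n + 1) = 0 := fun n => by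
    simp only [d, Category.assoc]
    rw [reassoc_of% (isShortExact_threeTerm h (n + 1)).1, zero_comp, comp_zero]
  exact ⟨CochainComplex.of _ d hd, ⟨threeTermZ A C, threeTermι C f, threeTermπ A g, fun n =>
    ⟨CochainComplex.of_d (threeTermX A B C) d n, isShortExact_threeTerm h n⟩⟩, rfl⟩

/-- The acyclic complex `A ⟶ B ⟶ C` has class zero, while its class is also the alternating sum of
the classes of its terms. -/
lemma objectClass_of_isShortExact {A B C : E} {f : A ⟶ B} {g : B ⟶ C} (h : IsShortExact f g) :
    (objectClass A - objectClass B + objectClass C :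
      TriangulatedK0 (BoundedDerivedCategory E)) = 0 := by
  obtain ⟨K, hK, hX⟩ := exists_isAcyclic_of_isShortExact h
  have hz : ∀ n : ℤ, (n < 0 ∨ 0 + (3 : ℕ) ≤ n) → IsZero (K.X n) := fun n hn => by
    rw [hX]
    match n with
    | .ofNat 0 | .ofNat 1 | .ofNat 2 => simp at hn
    | .ofNat (_ + 3) => exact isZero_zero E
    | .negSucc n => exact isZero_zero E
  have hb : bounded E ((HomotopyCategory.quotient _ _).obj K) :=
    ⟨0, 2, fun n hn => hz n (by omega)⟩
  have h₀ := complexClass_eq_eulerChar K hb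
  rw [complexClass_eq_zero_of_isAcyclic hK hb,
    eulerChar_eq_sum_range (fun _ => objectClass_eq_zero) 0 3 hz, hX] at h₀
  simp only [Finset.sum_range_succ, Finset.sum_range_zero] at h₀
  have e₀ : threeTermX A B C (0 + (0 : ℕ)) = A := rfl
  have e₁ : threeTermX A B C (0 + (1 : ℕ)) = B := rfl
  have e₂ : threeTermX A B C (0 + (2 : ℕ)) = C := rfl
  have s₂ : (2 : ℤ).negOnePow = 1 := rfl
  rw [e₀, e₁, e₂] at h₀
  simpa [s₂, sub_eq_add_neg] using h₀.symm

end ThreeTermComplex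

/-! ### The comparison homomorphism and its inverse. -/

section Comparison

variable {E : Type u} [Category.{v} E] [Preadditive E] [HasZeroObject E] [HasBinaryBiproducts E]
  [ExactCategory E]

/-- The homomorphism `K₀(E) → K₀(D^b(E))` induced by the canonical functor. -/
noncomputable def comparisonHom : ExactK0 E →+ TriangulatedK0 (BoundedDerivedCategory E) :=
  QuotientAddGroup.lift _ (FreeAbelianGroup.lift (Quotient.lift objectClass
    (fun _ _ ⟨e⟩ => objectClass_eq_of_iso e))) (by
      rw [AddSubgroup.closure_le]
      rintro _ ⟨A, B, C, f, g, h, rfl⟩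
      rw [SetLike.mem_coe, AddMonoidHom.mem_ker, map_add, map_sub]
      simp only [isoClassOf, FreeAbelianGroup.lift_apply_of]
      exact objectClass_of_isShortExact h)

lemma comparisonHom_mk (X : E) : comparisonHom (ExactK0.mk X) = objectClass X :=
  (QuotientAddGroup.lift_mk _ _ _).trans (FreeAbelianGroup.lift_apply_of _ _)

lemma comparisonHom_eulerChar (K : CochainComplex E ℤ)
    (h : bounded E ((HomotopyCategory.quotient _ _).obj K)) :
    comparisonHom (eulerChar ExactK0.mk K) = complexClass K h := by
  have hs := h
  obtain ⟨a, b, hs⟩ := hs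
  rw [complexClass_eq_eulerChar, eulerChar, eulerChar, AddMonoidHom.map_finsum]
  · refine finsum_congr (fun n => ?_)
    rw [Units.smul_def, Units.smul_def, map_zsmul, comparisonHom_mk]
  · exact hasFiniteSupport_of_isZero (fun _ => ExactK0.mk_eq_zero) hs

lemma eulerChar_single (X : E) :
    eulerChar ExactK0.mk ((HomologicalComplex.single E (ComplexShape.up ℤ) 0).obj X) =
      ExactK0.mk X := by
  rw [eulerChar, finsum_eq_single _ 0 (fun n hn => by
    rw [ExactK0.mk_eq_zero (HomologicalComplex.isZero_single_obj_X _ _ _ _ hn), smul_zero])]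
  rw [ExactK0.mk_eq_of_iso (HomologicalComplex.singleObjXSelf (ComplexShape.up ℤ) 0 X)]
  simp

end Comparison

end ExactCat

theorem mainTheorem8 {E : Type u} [Category.{v} E] [Preadditive E] [HasZeroObject E]
    [HasBinaryBiproducts E] [ExactCat.ExactCategory E] [EssentiallySmall.{w} E]
    (hE : ExactCat.IsWeaklyIdempotentComplete E) :
    ∃ φ : ExactCat.ExactK0 E ≃+ ExactCat.TriangulatedK0 (ExactCat.BoundedDerivedCategory E),
      ∀ X : E, φ (ExactCat.ExactK0.mk X) =
        ExactCat.TriangulatedK0.mk ((ExactCat.toBoundedDerivedCategory E).obj X) := by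
  obtain ⟨χ, hχ⟩ := ExactCat.exists_eulerCharHom hE
  have hX : ∀ X : E, χ (ExactCat.objectClass X) = ExactCat.ExactK0.mk X := fun X =>
    (hχ ((ExactCat.toBoundedHomotopyCategory E).obj X)).trans (ExactCat.eulerChar_single X)
  refine ⟨AddMonoidHom.toAddEquiv ExactCat.comparisonHom χ ?_ ?_,
    fun X => ExactCat.comparisonHom_mk X⟩
  · ext x
    obtain ⟨X, rfl⟩ := Quotient.exists_rep x
    exact (congrArg χ (ExactCat.comparisonHom_mk X)).trans (hX X)
  -- Every object of `D^b(E)` is represented by a bounded complex, whose class is recovered from its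
  -- Euler characteristic.
  · ext x
    obtain ⟨X, rfl⟩ := Quotient.exists_rep x
    obtain ⟨K, ⟨e⟩⟩ := ExactCat.exists_Q_obj_iso X
    have h : ExactCat.comparisonHom (χ (ExactCat.TriangulatedK0.mk X)) =
        ExactCat.TriangulatedK0.mk X := by
      rw [← ExactCat.TriangulatedK0.mk_eq_of_iso e, hχ]
      exact ExactCat.comparisonHom_eulerChar K.obj.as K.property
    exact h
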